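/- Let $(p_i)_{i\ge 1}$ be a probability distribution on $\mathbb{N}=\{1,2,\ldots\}$ and let $\xi$ be a random variable with $\mathbb{P}\{\xi=i\}=p_i$. Assume that $\mu:=\mathbb{E}\xi\in(1,\infty)$ and $\mathbb{E}\,\xi\log\xi<\infty$. Leader election: let $\xi_k^{(n)}$, $k,n\in\mathbb{N}$, be independent copies of $\xi$ and let $R^{(n)}(j):=\xi_1^{(n)}+\cdots+\xi_j^{(n)}$. For $M\in\mathbb{N}_0$ put $N_M^{(0)}:=M$ and $N_M^{(n)}:=\#\{j\in\mathbb{N}: R^{(n)}(j)\le N_M^{(n-1)}\}$ for $n\in\mathbb{N}$ (the number of players among $1,\ldots,M$ who survive the first $n$ rounds, where in each round $n$ exactly the players whose current labels are $R^{(n)}(1),R^{(n)}(2),\ldots$ stay and are relabelled $1,2,\ldots$). Let $T(M):=\inf\{n\in\mathbb{N}:N_M^{(n)}=0\}$, with $\inf\varnothing:=\infty$, be the number of rounds until the players $1,\ldots,M$ are all eliminated. Galton–Watson process: let $(Z_n)_{n\ge 0}$ be a Galton–Watson process with $Z_0=1$ and offspring distribution $(p_i)_{i\ge1}$, and let $Z_\infty:=\lim_{n\to\infty}\mu^{-n}Z_n$.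 Then this limit exists almost surely in $[0,\infty)$, $T(M)<\infty$ almost surely for every $M$, and for every fixed $x>0$, $$T(\lfloor\mu^n x\rfloor)-n\ \longrightarrow\ T'(x)\quad\text{in distribution as } n\to\infty,$$ where $T'(x)$ is a $\mathbb{Z}$-valued random variable whose distribution is well defined and given by $$\mathbb{P}\{T'(x)\le k\}=\mathbb{P}\{Z_\infty>\mu^{-k}x\},\qquad k\in\mathbb{Z}.$$ -/

import Mathlib

open MeasureTheory ProbabilityTheory Filter Topology

namespace LeaderElection

/-- The random walk `R(k) = ξ₁ + ⋯ + ξₖ` of one round, `R(0) = 0`; the increments of the round are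
listed from index `0`, so `step i` is the increment `ξ_{i+1}`. -/
def walk (step : ℕ → ℕ) (k : ℕ) : ℕ := ∑ i ∈ Finset.range k, step i

/-- `survivors a M n` is the number of players among `1, …, M` who survive the first `n` rounds:
`N⁽⁰⁾ = M` and `N⁽ⁿ⁾ = #{j ≥ 1 : R⁽ⁿ⁾(j) ≤ N⁽ⁿ⁻¹⁾}`. Rounds are listed from index `0`, so the
increments of the `(n+1)`-st round are `a n 0, a n 1, …`. If all increments are positive, the
sets counted here are finite. -/
noncomputable def survivors (a : ℕ → ℕ → ℕ) (M : ℕ) : ℕ → ℕ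
  | 0 => M
  | n + 1 => {j : ℕ | 1 ≤ j ∧ walk (a n) j ≤ survivors a M n}.ncard

/-- The number of rounds until all players `1, …, M` are eliminated,
`T(M) = inf {n ≥ 1 : N⁽ⁿ⁾ = 0}`, with `inf ∅ = ∞`. -/
noncomputable def rounds (a : ℕ → ℕ → ℕ) (M : ℕ) : ℕ∞ :=
  sInf ((fun n : ℕ => (n : ℕ∞)) '' {n : ℕ | 1 ≤ n ∧ survivors a M n = 0})

/-- The Galton-Watson process with one ancestor; `b n i` is the number of children of
the `(i+1)`-st individual of generation `n`. -/
def galtonWatson (b : ℕ → ℕ → ℕ) : ℕ → ℕ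
  | 0 => 1
  | n + 1 => ∑ i ∈ Finset.range (galtonWatson b n), b n i

/-- The limit `Z_∞` of the normalized process `μ⁻ⁿ Zₙ` (an arbitrary real number where the limit
does not exist). -/
noncomputable def gwLimit (μ : ℝ) (b : ℕ → ℕ → ℕ) : ℝ :=
  limUnder atTop (fun n : ℕ => (galtonWatson b n : ℝ) / μ ^ n)

/-- `X n k`, `n, k ∈ ℕ`, are independent random variables on `(Ω, P)`, each with the law `p`. -/
structure IsIIDArray {Ω : Type*} [MeasurableSpace Ω] (X : ℕ → ℕ → Ω → ℕ) (p : PMF ℕ)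
    (P : Measure Ω) : Prop where
  measurable : ∀ n k, Measurable (X n k)
  law : ∀ n k, P.map (X n k) = p.toMeasure
  indep : iIndepFun (fun i : ℕ × ℕ => X i.1 i.2) P

end LeaderElection

/-! A player survives `n` rounds exactly when some label `j ≥ 1` traces back to that player through
the walks of the rounds. Hence everyone among `1, …, M` is gone after `n` rounds iff the original
label of the final player `1`, namely `R⁽¹⁾(R⁽²⁾(⋯R⁽ⁿ⁾(1)))`, exceeds `M` (`survivors_eq_zero_iff`).
Read from the inside out, this composition is a Galton-Watson process run on the rounds in reverse
order (`galtonWatson_reverse`). Reversing finitely many i.i.d. rows preserves the law, so `P(T(M) ≤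
n) = P(Zₙ > M)` for each fixed `n ≥ 1`. With `M = ⌊μⁿx⌋` this gives `P(T(M) - n ≤ k) = P(Z_{n+k} /
μ^{n+k} > μ⁻ᵏx)` once `n + k ≥ 1`.

It remains to pass to the limit at every threshold. Martingale convergence gives `Z_∞`. The `x log
x` condition makes `Z_∞` nonzero with positive probability (`exists_pgf_iterate_le`). The
fixed-point equation saying that `μ Z_∞` is distributed as a sum of `ξ` independent copies of `Z_∞`
then excludes atoms (`measure_singleton_eq_zero_of_map_eq_compound`), unless `ξ` is constant. In
that case the normalized process is constantly `1` and convergence is trivial. Absence of an atom at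
`0` also yields `Z_∞ > 0` and `T(M) < ∞` almost surely. -/

namespace LeaderElection

/-! ### Pathwise duality between survivors and Galton-Watson generations -/

section Deterministic

lemma walk_succ (s : ℕ → ℕ) (k : ℕ) : walk s (k + 1) = walk s k + s k :=
  Finset.sum_range_succ _ _

lemma walk_monotone (s : ℕ → ℕ) : Monotone (walk s) :=
  monotone_nat_of_le_succ fun k => by rw [walk_succ]; omega

lemma le_walk {s : ℕ → ℕ} (hs : ∀ i, 0 < s i) (k : ℕ) : k ≤ walk s k := by
  induction k with
  | zero => simp
  | succ k ih => rw [walk_succ]; have := hs k; omega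

/-- The walk is monotone, so the counted set is an initial segment of `{1, 2, …}`. Positive steps
make it finite; for an infinite set `ncard` would be `0`. -/
lemma le_ncard_walk_iff {s : ℕ → ℕ} (hs : ∀ i, 0 < s i) (N : ℕ) {j : ℕ} (hj : 1 ≤ j) :
    j ≤ {i : ℕ | 1 ≤ i ∧ walk s i ≤ N}.ncard ↔ walk s j ≤ N := by
  have hfin : {i : ℕ | 1 ≤ i ∧ walk s i ≤ N}.Finite :=
    (Set.finite_Iic N).subset fun i hi => (le_walk hs i).trans hi.2
  constructor
  · intro h
    by_contra hc
    have hsub : {i : ℕ | 1 ≤ i ∧ walk s i ≤ N} ⊆ ((Finset.Icc 1 (j - 1) : Finset ℕ) : Set ℕ) := by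
      intro i hi
      have : i < j := by
        by_contra hij
        exact hc ((walk_monotone s (not_lt.1 hij)).trans hi.2)
      have h1 := hi.1
      simp only [Finset.coe_Icc, Set.mem_Icc]
      omega
    have := Set.ncard_le_ncard hsub (Finset.finite_toSet _)
    rw [Set.ncard_coe_finset, Nat.card_Icc] at this
    omega
  · intro h
    have hsub : ((Finset.Icc 1 j : Finset ℕ) : Set ℕ) ⊆ {i : ℕ | 1 ≤ i ∧ walk s i ≤ N} := by
      intro i hi
      simp only [Finset.coe_Icc, Set.mem_Icc] at hi
      exact ⟨hi.1, (walk_monotone s hi.2).trans h⟩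
    have := Set.ncard_le_ncard hsub hfin
    rw [Set.ncard_coe_finset, Nat.card_Icc] at this
    omega

/-- The original label of the player who carries the label `j` after `n` rounds. -/
def initialLabel (a : ℕ → ℕ → ℕ) : ℕ → ℕ → ℕ
  | 0, j => j
  | n + 1, j => initialLabel a n (walk (a n) j)

lemma le_survivors_iff {a : ℕ → ℕ → ℕ} (ha : ∀ n i, 0 < a n i) (M n : ℕ) {j : ℕ} (hj : 1 ≤ j) :
    j ≤ survivors a M n ↔ initialLabel a n j ≤ M := by
  induction n generalizing j with
  | zero => rfl
  | succ n ih =>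
    rw [survivors, le_ncard_walk_iff (ha n) _ hj, initialLabel]
    exact ih (hj.trans (le_walk (ha n) j))

lemma survivors_antitone {a : ℕ → ℕ → ℕ} (ha : ∀ n i, 0 < a n i) (M : ℕ) :
    Antitone (survivors a M) := by
  refine antitone_nat_of_succ_le fun n => ?_
  rcases Nat.eq_zero_or_pos (survivors a M (n + 1)) with h | h
  · omega
  · have h1 : walk (a n) (survivors a M (n + 1)) ≤ survivors a M n :=
      (le_ncard_walk_iff (ha n) _ h).1 le_rfl
    exact (le_walk (ha n) _).trans h1

lemma galtonWatson_succ (b : ℕ → ℕ → ℕ) (n : ℕ) :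
    galtonWatson b (n + 1) = walk (b n) (galtonWatson b n) := rfl

lemma galtonWatson_reverse (a b : ℕ → ℕ → ℕ) (n : ℕ) (hb : ∀ m < n, b m = a (n - 1 - m)) :
    galtonWatson b n = initialLabel a n 1 := by
  -- Peel rounds off from the last one: `m` generations account for the last `m` rounds, and the
  -- first `n - m` rounds remain to be undone.
  have key : ∀ m ≤ n, initialLabel a (n - m) (galtonWatson b m) = initialLabel a n 1 := by
    intro m
    induction m with
    | zero => intro _; rfl
    | succ m ih =>
      intro hm
      rw [← ih (by omega), show n - m = (n - (m + 1)) + 1 by omega, initialLabel,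
        galtonWatson_succ, hb m (by omega), show n - 1 - m = n - (m + 1) by omega]
  simpa [initialLabel] using key n le_rfl

lemma survivors_eq_zero_iff {a : ℕ → ℕ → ℕ} (ha : ∀ n i, 0 < a n i) (M n : ℕ) :
    survivors a M n = 0 ↔ M < initialLabel a n 1 := by
  rw [← not_le, ← le_survivors_iff ha M n le_rfl]
  omega

/-- Survivor counts never increase, so the infimum can be tested at round `n` alone. At `n = 0` the
equivalence fails for `M = 0`: the infimum runs over `n ≥ 1`, whereas `0 < 1` holds on the right. -/
lemma rounds_le_iff {a : ℕ → ℕ → ℕ} (ha : ∀ n i, 0 < a n i) (M : ℕ) {n : ℕ} (hn : 1 ≤ n) :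
    rounds a M ≤ n ↔ M < initialLabel a n 1 := by
  rw [← survivors_eq_zero_iff ha]
  constructor
  · intro h
    have hlt : rounds a M < ((n + 1 : ℕ) : ℕ∞) :=
      h.trans_lt (by exact_mod_cast Nat.lt_succ_self n)
    obtain ⟨_, ⟨m, hm, rfl⟩, hmn⟩ := sInf_lt_iff.1 hlt
    have hmn' : m ≤ n := by
      have : m < n + 1 := Nat.cast_lt.1 hmn
      omega
    have := survivors_antitone ha M hmn'
    have := hm.2
    omega
  · intro h
    exact sInf_le ⟨n, ⟨hn, h⟩, rfl⟩

lemma walk_const (m k : ℕ) : walk (fun _ => m) k = k * m := by simp [walk]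

lemma galtonWatson_const (m n : ℕ) : galtonWatson (fun _ _ => m) n = m ^ n := by
  induction n with
  | zero => rfl
  | succ n ih => rw [galtonWatson_succ, walk_const, ih, pow_succ]

end Deterministic

/-! ### I.i.d. arrays: measurability, independence of rows, laws -/

section Array

variable {Ω : Type*}

lemma measurable_walk_uncurry : Measurable (fun q : ℕ × (ℕ → ℕ) => walk q.2 q.1) := by
  refine measurable_from_prod_countable_right fun k => ?_
  have h : Measurable (fun y : ℕ → ℕ => ∑ i ∈ Finset.range k, y i) :=
    Finset.measurable_fun_sum _ fun i _ => measurable_pi_apply i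
  exact h

lemma measurable_galtonWatson {m : MeasurableSpace Ω} {X : ℕ → ℕ → Ω → ℕ} {n : ℕ}
    (hX : ∀ k < n, ∀ i, Measurable (X k i)) :
    Measurable (fun ω => galtonWatson (fun k i => X k i ω) n) := by
  induction n with
  | zero => exact measurable_const
  | succ n ih =>
    exact measurable_walk_uncurry.comp
      ((ih fun k hk => hX k (by omega)).prodMk (measurable_pi_lambda _ fun i => hX n (by omega) i))

/-- The σ-algebra generated by the rows of the array with index in `S`. -/
abbrev rowSigma (X : ℕ → ℕ → Ω → ℕ) (S : Set ℕ) : MeasurableSpace Ω :=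
  ⨆ q ∈ {q : ℕ × ℕ | q.1 ∈ S}, MeasurableSpace.comap (X q.1 q.2) inferInstance

lemma measurable_rowSigma (X : ℕ → ℕ → Ω → ℕ) {S : Set ℕ} {n : ℕ} (hn : n ∈ S) (i : ℕ) :
    Measurable[rowSigma X S] (X n i) :=
  (comap_measurable (X n i)).mono
    (le_iSup₂_of_le (f := fun q (_ : q ∈ {q : ℕ × ℕ | q.1 ∈ S}) =>
      MeasurableSpace.comap (X q.1 q.2) inferInstance) (n, i) hn le_rfl) le_rfl

lemma rowSigma_mono (X : ℕ → ℕ → Ω → ℕ) {S T : Set ℕ} (h : S ⊆ T) : rowSigma X S ≤ rowSigma X T :=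
  biSup_mono fun _ hq => h hq

lemma measurable_galtonWatson_rowSigma (X : ℕ → ℕ → Ω → ℕ) (n : ℕ) :
    Measurable[rowSigma X (Set.Iio n)] (fun ω => galtonWatson (fun k i => X k i ω) n) :=
  measurable_galtonWatson (m := rowSigma X (Set.Iio n)) fun k hk i =>
    measurable_rowSigma X (S := Set.Iio n) (n := k) hk i

variable [MeasurableSpace Ω] {P : Measure Ω} {p : PMF ℕ} {X : ℕ → ℕ → Ω → ℕ}

namespace IsIIDArray

lemma rowSigma_le (hX : IsIIDArray X p P) (S : Set ℕ) : rowSigma X S ≤ ‹MeasurableSpace Ω› :=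
  iSup₂_le fun q _ => (hX.measurable q.1 q.2).comap_le

lemma indep_rowSigma (hX : IsIIDArray X p P) {S T : Set ℕ} (h : Disjoint S T) :
    Indep (rowSigma X S) (rowSigma X T) P :=
  indep_iSup_of_disjoint
    (m := fun q : ℕ × ℕ => MeasurableSpace.comap (X q.1 q.2) inferInstance)
    (fun q => (hX.measurable q.1 q.2).comap_le) hX.indep.iIndep
    (S := {q : ℕ × ℕ | q.1 ∈ S}) (T := {q : ℕ × ℕ | q.1 ∈ T})
    (Set.disjoint_left.2 fun _ hq hq' => Set.disjoint_left.1 h hq hq')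

lemma reindex (hX : IsIIDArray X p P) {σ : ℕ → ℕ} (hσ : σ.Injective) :
    IsIIDArray (fun n => X (σ n)) p P where
  measurable n k := hX.measurable _ _
  law n k := hX.law _ _
  indep := hX.indep.precomp (g := fun q : ℕ × ℕ => (σ q.1, q.2))
    fun a b h => by
      simp only [Prod.mk.injEq] at h
      exact Prod.ext (hσ h.1) h.2

lemma ae_pos (hX : IsIIDArray X p P) (hp0 : p 0 = 0) : ∀ᵐ ω ∂P, ∀ n i, 0 < X n i ω := by
  refine ae_all_iff.2 fun n => ae_all_iff.2 fun i => ?_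
  have h : P (X n i ⁻¹' {0}) = 0 := by
    rw [← Measure.map_apply (hX.measurable n i) (measurableSet_singleton 0), hX.law,
      PMF.toMeasure_apply_singleton _ _ (measurableSet_singleton 0), hp0]
  filter_upwards [measure_eq_zero_iff_ae_notMem.1 h] with ω hω
  exact Nat.pos_of_ne_zero hω

lemma map_eq [IsProbabilityMeasure P] (hX : IsIIDArray X p P) :
    P.map (fun ω (q : ℕ × ℕ) => X q.1 q.2 ω) = Measure.infinitePi fun _ => p.toMeasure := by
  rw [hX.indep.map_fun_eq_infinitePi_map (X := fun q : ℕ × ℕ => X q.1 q.2)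
    fun q => hX.measurable q.1 q.2]
  simp_rw [hX.law]

/-- Both joint laws are the same infinite product measure. This transfers probabilities between the
election space and the branching space. -/
lemma measure_eq [IsProbabilityMeasure P] {Ω' : Type*} [MeasurableSpace Ω'] {P' : Measure Ω'}
    [IsProbabilityMeasure P'] {Y : ℕ → ℕ → Ω' → ℕ} (hX : IsIIDArray X p P)
    (hY : IsIIDArray Y p P') (n : ℕ) (S : Set ℕ) :
    P {ω | galtonWatson (fun k i => X k i ω) n ∈ S}
      = P' {ω | galtonWatson (fun k i => Y k i ω) n ∈ S} := by
  have hS : MeasurableSet {x : ℕ × ℕ → ℕ | galtonWatson (fun k i => x (k, i)) n ∈ S} :=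
    measurable_galtonWatson (X := fun k i (x : ℕ × ℕ → ℕ) => x (k, i))
      (fun k _ i => measurable_pi_apply _) (MeasurableSet.of_discrete (s := S))
  have h1 := Measure.map_apply (μ := P)
    (measurable_pi_lambda (fun ω (q : ℕ × ℕ) => X q.1 q.2 ω) fun q => hX.measurable q.1 q.2) hS
  have h2 := Measure.map_apply (μ := P')
    (measurable_pi_lambda (fun ω (q : ℕ × ℕ) => Y q.1 q.2 ω) fun q => hY.measurable q.1 q.2) hS
  rw [hX.map_eq] at h1
  rw [hY.map_eq] at h2
  exact h1.symm.trans h2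

end IsIIDArray

/-- The filtration generated by the successive rows of the array. -/
def rowFiltration (hX : IsIIDArray X p P) : Filtration ℕ ‹MeasurableSpace Ω› where
  seq n := rowSigma X (Set.Iio n)
  mono' _ _ h := rowSigma_mono X (Set.Iio_subset_Iio h)
  le' _ := hX.rowSigma_le _

/-! ### The martingale `μ⁻ⁿ Zₙ` and its almost sure limit -/

lemma lintegral_toMeasure_natCast {μ : ℝ} (hμ : HasSum (fun i : ℕ => (p i).toReal * (i : ℝ)) μ) :
    ∫⁻ k, (k : ENNReal) ∂p.toMeasure = ENNReal.ofReal μ := by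
  rw [lintegral_countable', ← hμ.tsum_eq,
    ENNReal.ofReal_tsum_of_nonneg (fun n => by positivity) hμ.summable]
  refine tsum_congr fun k => ?_
  rw [PMF.toMeasure_apply_singleton _ _ (measurableSet_singleton k),
    ENNReal.ofReal_mul ENNReal.toReal_nonneg, ENNReal.ofReal_toReal (p.apply_ne_top k),
    ENNReal.ofReal_natCast, mul_comm]

/-- Wald's identity on events of the past: `{i < Zₙ}` depends only on rows before `n`, hence is
independent of row `n`. Working in `ENNReal` means no integrability is needed beforehand. -/
lemma IsIIDArray.setLIntegral_galtonWatson_succ (hX : IsIIDArray X p P) {μ : ℝ}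
    (hμ : HasSum (fun i : ℕ => (p i).toReal * (i : ℝ)) μ) (n : ℕ) {A : Set Ω}
    (hA : MeasurableSet[rowSigma X (Set.Iio n)] A) :
    ∫⁻ ω in A, (galtonWatson (fun k i => X k i ω) (n + 1) : ENNReal) ∂P
      = ENNReal.ofReal μ * ∫⁻ ω in A, (galtonWatson (fun k i => X k i ω) n : ENNReal) ∂P := by
  set Z : Ω → ℕ := fun ω => galtonWatson (fun k i => X k i ω) n with hZ
  have hA' : MeasurableSet A := hX.rowSigma_le _ _ hA
  have hZm : Measurable[rowSigma X (Set.Iio n)] Z := measurable_galtonWatson_rowSigma X n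
  have hlt : ∀ i, MeasurableSet[rowSigma X (Set.Iio n)] (A ∩ {ω | i < Z ω}) := fun i =>
    @MeasurableSet.inter _ (rowSigma X (Set.Iio n)) _ _ hA
      (hZm (MeasurableSet.of_discrete (s := Set.Ioi i)))
  have hlt' : ∀ i, MeasurableSet (A ∩ {ω | i < Z ω}) := fun i => hX.rowSigma_le _ _ (hlt i)
  -- A sum of random length becomes a series with indicator weights, so that sum and integral can be
  -- exchanged.
  have hsum : ∀ (ω : Ω) (g : ℕ → ENNReal),
      A.indicator (fun ω => ∑ i ∈ Finset.range (Z ω), g i) ω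
        = ∑' i, (A ∩ {ω | i < Z ω}).indicator 1 ω * g i := by
    intro ω g
    by_cases hω : ω ∈ A
    · rw [Set.indicator_of_mem hω, tsum_eq_sum (s := Finset.range (Z ω))]
      · refine Finset.sum_congr rfl fun i hi => ?_
        simp [Set.indicator, hω, Finset.mem_range.1 hi]
      · intro i hi
        simp only [Finset.mem_range] at hi
        simp [Set.indicator, hi]
    · simp [Set.indicator, hω]
  have hmeas : ∀ i, Measurable ((A ∩ {ω | i < Z ω}).indicator (1 : Ω → ENNReal)) := fun i =>
    measurable_one.indicator (hlt' i)
  have hXe : ∀ i, Measurable (fun ω => (X n i ω : ENNReal)) := fun i =>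
    measurable_from_top.comp (hX.measurable n i)
  have h1 : ∀ i, ∫⁻ ω, (A ∩ {ω | i < Z ω}).indicator 1 ω * (X n i ω : ENNReal) ∂P
      = (∫⁻ ω, (A ∩ {ω | i < Z ω}).indicator 1 ω ∂P) * ENNReal.ofReal μ := by
    intro i
    have hf : Measurable[rowSigma X (Set.Iio n)]
        ((A ∩ {ω | i < Z ω}).indicator (fun _ => (1 : ENNReal))) :=
      (@measurable_const _ _ _ (rowSigma X (Set.Iio n)) 1).indicator (hlt i)
    have hg : Measurable[rowSigma X {n}] (fun ω => (X n i ω : ENNReal)) :=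
      (measurable_from_top (f := fun k : ℕ => (k : ENNReal))).comp
        (measurable_rowSigma X (Set.mem_singleton n) i)
    refine (lintegral_mul_eq_lintegral_mul_lintegral_of_independent_measurableSpace
      (hX.rowSigma_le (Set.Iio n)) (hX.rowSigma_le {n}) (hX.indep_rowSigma (by simp))
      hf hg).trans ?_
    rw [← lintegral_toMeasure_natCast hμ, ← hX.law n i,
      lintegral_map measurable_from_top (hX.measurable n i)]
    rfl
  have h2 : ∀ ω, A.indicator (fun ω => (galtonWatson (fun k i => X k i ω) (n + 1) : ENNReal)) ω
      = ∑' i, (A ∩ {ω | i < Z ω}).indicator 1 ω * (X n i ω : ENNReal) := by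
    intro ω
    rw [← hsum ω fun i => (X n i ω : ENNReal)]
    simp [Set.indicator, galtonWatson, hZ]
  have h3 : ∀ ω, A.indicator (fun ω => (Z ω : ENNReal)) ω
      = ∑' i, (A ∩ {ω | i < Z ω}).indicator 1 ω * 1 := by
    intro ω
    rw [← hsum ω fun i => 1]
    simp [Set.indicator]
  rw [← lintegral_indicator hA', ← lintegral_indicator hA']
  have e1 := lintegral_tsum (μ := P)
    (f := fun i ω => (A ∩ {ω | i < Z ω}).indicator 1 ω * (X n i ω : ENNReal))
    fun i => ((hmeas i).mul (hXe i)).aemeasurable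
  have e2 := lintegral_tsum (μ := P)
    (f := fun i ω => (A ∩ {ω | i < Z ω}).indicator 1 ω * (1 : ENNReal))
    fun i => ((hmeas i).mul_const 1).aemeasurable
  rw [(lintegral_congr h2).trans e1, (lintegral_congr h3).trans e2, ← ENNReal.tsum_mul_left]
  refine tsum_congr fun i => ?_
  rw [h1, mul_comm]
  simp

lemma IsIIDArray.lintegral_galtonWatson [IsProbabilityMeasure P] (hX : IsIIDArray X p P) {μ : ℝ}
    (hμ : HasSum (fun i : ℕ => (p i).toReal * (i : ℝ)) μ) (n : ℕ) :
    ∫⁻ ω, (galtonWatson (fun k i => X k i ω) n : ENNReal) ∂P = ENNReal.ofReal μ ^ n := by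
  induction n with
  | zero => simp [galtonWatson]
  | succ n ih =>
    have := hX.setLIntegral_galtonWatson_succ hμ n (A := Set.univ)
      (@MeasurableSet.univ _ (rowSigma X (Set.Iio n)))
    simp only [Measure.restrict_univ] at this
    rw [this, ih, pow_succ, mul_comm]

lemma IsIIDArray.integrable_galtonWatson [IsProbabilityMeasure P] (hX : IsIIDArray X p P) {μ : ℝ}
    (hμ : HasSum (fun i : ℕ => (p i).toReal * (i : ℝ)) μ) (n : ℕ) :
    Integrable (fun ω => (galtonWatson (fun k i => X k i ω) n : ℝ)) P := by
  refine ⟨(measurable_from_top.comp (measurable_galtonWatson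
    fun k _ i => hX.measurable k i)).aestronglyMeasurable, ?_⟩
  rw [hasFiniteIntegral_iff_enorm]
  have : ∀ ω, ‖(galtonWatson (fun k i => X k i ω) n : ℝ)‖ₑ
      = (galtonWatson (fun k i => X k i ω) n : ENNReal) := fun ω => by simp
  simp_rw [this, hX.lintegral_galtonWatson hμ]
  exact ENNReal.pow_lt_top ENNReal.ofReal_lt_top

lemma setIntegral_natCast {Z : Ω → ℕ} (hZ : Measurable Z) (A : Set Ω) :
    ∫ ω in A, (Z ω : ℝ) ∂P = (∫⁻ ω in A, (Z ω : ENNReal) ∂P).toReal := by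
  rw [integral_eq_lintegral_of_nonneg_ae (ae_of_all _ fun _ => Nat.cast_nonneg _)
    (measurable_from_top.comp hZ).aestronglyMeasurable]
  simp

lemma IsIIDArray.martingale [IsProbabilityMeasure P] (hX : IsIIDArray X p P) {μ : ℝ}
    (hμ : HasSum (fun i : ℕ => (p i).toReal * (i : ℝ)) μ) (hμ1 : 1 < μ) :
    Martingale (fun n ω => (galtonWatson (fun k i => X k i ω) n : ℝ) / μ ^ n)
      (rowFiltration hX) P := by
  refine martingale_of_setIntegral_eq_succ (fun n => ?_) (fun n => ?_) (fun n A hA => ?_)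
  · exact Measurable.stronglyMeasurable (Measurable.div_const
      (Measurable.comp (g := fun k : ℕ => (k : ℝ)) measurable_from_top
        (measurable_galtonWatson_rowSigma X n)) _)
  · exact (hX.integrable_galtonWatson hμ n).div_const _
  · have hm : ∀ n, Measurable (fun ω => galtonWatson (fun k i => X k i ω) n) := fun n =>
      measurable_galtonWatson fun k _ i => hX.measurable k i
    rw [integral_div, integral_div, setIntegral_natCast (hm n), setIntegral_natCast (hm (n + 1)),
      hX.setLIntegral_galtonWatson_succ hμ n hA, ENNReal.toReal_mul,
      ENNReal.toReal_ofReal (by linarith), pow_succ, mul_comm (μ ^ n) μ,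
      mul_div_mul_left _ _ (by linarith)]

/-- Doob's convergence theorem: the martingale is nonnegative with mean `1`, hence bounded in `L¹`.
-/
lemma IsIIDArray.ae_tendsto_gwLimit [IsProbabilityMeasure P] (hX : IsIIDArray X p P) {μ : ℝ}
    (hμ : HasSum (fun i : ℕ => (p i).toReal * (i : ℝ)) μ) (hμ1 : 1 < μ) :
    ∀ᵐ ω ∂P, Tendsto (fun n : ℕ => (galtonWatson (fun m i => X m i ω) n : ℝ) / μ ^ n) atTop
      (𝓝 (gwLimit μ (fun m i => X m i ω))) := by
  have hb : ∀ n, eLpNorm (fun ω => (galtonWatson (fun k i => X k i ω) n : ℝ) / μ ^ n) 1 P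
      ≤ (1 : NNReal) := by
    intro n
    have hpos : 0 < μ ^ n := by positivity
    rw [eLpNorm_one_eq_lintegral_enorm]
    have : ∀ ω, ‖(galtonWatson (fun k i => X k i ω) n : ℝ) / μ ^ n‖ₑ
        = (galtonWatson (fun k i => X k i ω) n : ENNReal) * ENNReal.ofReal (μ ^ n)⁻¹ := fun ω => by
      rw [Real.enorm_of_nonneg (by positivity), div_eq_mul_inv,
        ENNReal.ofReal_mul (Nat.cast_nonneg _), ENNReal.ofReal_natCast]
    simp_rw [this]
    rw [lintegral_mul_const' _ _ ENNReal.ofReal_ne_top, hX.lintegral_galtonWatson hμ,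
      ← ENNReal.ofReal_pow (by linarith), ← ENNReal.ofReal_mul hpos.le,
      mul_inv_cancel₀ hpos.ne']
    simp
  filter_upwards [(hX.martingale hμ hμ1).submartingale.exists_ae_tendsto_of_bdd hb] with ω hω
  exact tendsto_nhds_limUnder hω

end Array

/-! ### Generating functions, real for Laplace transforms and complex for characteristic functions
-/

section GeneratingFunction

variable {𝕜 : Type*} [RCLike 𝕜]

/-- The probability generating function of the law `p`. -/
noncomputable def pgf (p : PMF ℕ) (z : 𝕜) : 𝕜 := ∫ k, z ^ k ∂p.toMeasure

lemma integrable_pow_of_norm_le {α : Type*} [MeasurableSpace α] {m : Measure α} [IsFiniteMeasure m]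
    {f : α → ℕ} (hf : Measurable f) {z : 𝕜} (hz : ‖z‖ ≤ 1) : Integrable (fun a => z ^ f a) m := by
  refine Integrable.of_bound
    ((measurable_from_top (f := fun k : ℕ => z ^ k)).comp hf).aestronglyMeasurable 1
    (ae_of_all _ fun a => ?_)
  rw [norm_pow]
  exact pow_le_one₀ (norm_nonneg _) hz

lemma norm_pgf_le (p : PMF ℕ) {z : 𝕜} (hz : ‖z‖ ≤ 1) : ‖pgf p z‖ ≤ 1 := by
  refine (norm_integral_le_of_norm_le_const (C := 1) (ae_of_all _ fun k => ?_)).trans ?_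
  · rw [norm_pow]
    exact pow_le_one₀ (norm_nonneg _) hz
  · simp

lemma hasSum_pgf (p : PMF ℕ) {z : 𝕜} (hz : ‖z‖ ≤ 1) :
    HasSum (fun k => ((p k).toReal : 𝕜) * z ^ k) (pgf p z) := by
  have h := hasSum_integral_iUnion (μ := p.toMeasure) (s := fun k : ℕ => ({k} : Set ℕ))
    (f := fun k => z ^ k) (fun k => measurableSet_singleton k)
    (fun i j hij => by simpa using hij)
    (integrable_pow_of_norm_le measurable_id hz).integrableOn
  have hU : (⋃ k : ℕ, ({k} : Set ℕ)) = Set.univ := by ext; simp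
  rw [hU, Measure.restrict_univ] at h
  refine h.congr_fun ?_ |> fun h' => h'
  intro k
  rw [integral_singleton, Measure.real,
    PMF.toMeasure_apply_singleton _ _ (measurableSet_singleton k), RCLike.real_smul_eq_coe_mul]

lemma tendsto_pgf (p : PMF ℕ) {u : ℕ → 𝕜} {z : 𝕜} (hu : ∀ n, ‖u n‖ ≤ 1)
    (h : Tendsto u atTop (𝓝 z)) : Tendsto (fun n => pgf p (u n)) atTop (𝓝 (pgf p z)) := by
  refine tendsto_integral_of_dominated_convergence (fun _ => 1)
    (fun n => (measurable_from_top (f := fun k : ℕ => u n ^ k)).aestronglyMeasurable)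
    (integrable_const _) (fun n => ae_of_all _ fun k => ?_) (ae_of_all _ fun k => h.pow k)
  rw [norm_pow]
  exact pow_le_one₀ (norm_nonneg _) (hu n)

variable {Ω : Type*} [MeasurableSpace Ω] {P : Measure Ω} {p : PMF ℕ}
  {X : ℕ → ℕ → Ω → ℕ}

lemma IsIIDArray.integral_pow_walk (hX : IsIIDArray X p P) (z : 𝕜) (n k : ℕ) :
    ∫ ω, z ^ walk (fun i => X n i ω) k ∂P = pgf p z ^ k := by
  have hm : ∀ i, Measurable (fun ω => z ^ X n i ω) := fun i =>
    (measurable_from_top (f := fun k : ℕ => z ^ k)).comp (hX.measurable n i)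
  have hind : iIndepFun (fun (i : Fin k) ω => z ^ X n i ω) P :=
    (hX.indep.precomp (g := fun i : Fin k => (n, (i : ℕ))) fun a b h => by
      simpa [Fin.ext_iff] using h).comp (fun _ j => z ^ j) fun _ => measurable_from_top
  have h := hind.integral_fun_prod_eq_prod_integral fun i => (hm i).aestronglyMeasurable
  have h2 : ∀ i, ∫ ω, z ^ X n i ω ∂P = pgf p z := fun i => by
    rw [pgf, ← hX.law n i, integral_map (hX.measurable n i).aemeasurable
      measurable_from_top.aestronglyMeasurable]
  rw [Finset.prod_congr rfl fun (i : Fin k) _ => h2 i] at h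
  rw [Finset.prod_const, Finset.card_univ, Fintype.card_fin] at h
  rw [← h]
  refine integral_congr_ae (ae_of_all _ fun ω => ?_)
  simp only [walk]
  rw [Finset.prod_pow_eq_pow_sum, Finset.sum_range]

/-- Row `n` is independent of `Zₙ`, so integrating it out first replaces `z` by `pgf p z`. The
induction therefore has to allow all `z` in the unit disc. -/
lemma IsIIDArray.integral_pow_galtonWatson [IsProbabilityMeasure P] (hX : IsIIDArray X p P) (n : ℕ) {z : 𝕜}
    (hz : ‖z‖ ≤ 1) :
    ∫ ω, z ^ galtonWatson (fun k i => X k i ω) n ∂P = (pgf p)^[n] z := by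
  induction n generalizing z with
  | zero => simp [galtonWatson]
  | succ n ih =>
    rw [Function.iterate_succ_apply, ← ih (norm_pgf_le p hz)]
    set Z : Ω → ℕ := fun ω => galtonWatson (fun k i => X k i ω) n with hZ
    set Y : Ω → ℕ → ℕ := fun ω i => X n i ω with hY
    have hZm : Measurable Z := measurable_galtonWatson fun k _ i => hX.measurable k i
    have hYm : Measurable Y := measurable_pi_lambda _ fun i => hX.measurable n i
    have hYs : Measurable[rowSigma X {n}] Y :=
      @measurable_pi_lambda _ _ _ (rowSigma X {n}) _ _
        fun i => measurable_rowSigma X (Set.mem_singleton n) i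
    have hind : IndepFun Z Y P :=
      indep_of_indep_of_le_left (indep_of_indep_of_le_right
        (hX.indep_rowSigma (S := Set.Iio n) (T := {n}) (by simp)) hYs.comap_le)
        (measurable_galtonWatson_rowSigma X n).comap_le
    have hg : Measurable (fun q : ℕ × (ℕ → ℕ) => z ^ walk q.2 q.1) :=
      (measurable_from_top (f := fun k : ℕ => z ^ k)).comp measurable_walk_uncurry
    have h1 : ∫ ω, z ^ galtonWatson (fun k i => X k i ω) (n + 1) ∂P
        = ∫ q, z ^ walk q.2 q.1 ∂(P.map fun ω => (Z ω, Y ω)) := by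
      rw [integral_map (hZm.prodMk hYm).aemeasurable hg.aestronglyMeasurable]
      rfl
    have : IsProbabilityMeasure (P.map Z) := Measure.isProbabilityMeasure_map hZm.aemeasurable
    have : IsProbabilityMeasure (P.map Y) := Measure.isProbabilityMeasure_map hYm.aemeasurable
    rw [h1, (indepFun_iff_map_prod_eq_prod_map_map hZm.aemeasurable hYm.aemeasurable).1 hind,
      integral_prod _ (integrable_pow_of_norm_le measurable_walk_uncurry hz)]
    have h2 : ∀ k, ∫ y, z ^ walk y k ∂(P.map Y) = pgf p z ^ k := fun k => by
      rw [← hX.integral_pow_walk z n k]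
      exact integral_map hYm.aemeasurable
        (hg.comp (measurable_prodMk_left (x := k))).aestronglyMeasurable
    simp only [h2]
    rw [integral_map hZm.aemeasurable measurable_from_top.aestronglyMeasurable]

end GeneratingFunction

/-! ### Nondegeneracy of the limit under the `x log x` condition -/

section KestenStigum

/-- An upper bound for the relative deviation of `t ↦ 1 - f(1 - t)` from its linearization at `0`,
where `f` is the generating function of `p`. -/
noncomputable def deviation (p : PMF ℕ) (t : ℝ) : ℝ :=
  ∑' k : ℕ, (p k).toReal * ((k : ℝ) * min 1 (k * t))

variable {p : PMF ℕ} {μ : ℝ}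

lemma summable_deviation (hμ : HasSum (fun i : ℕ => (p i).toReal * (i : ℝ)) μ) {t : ℝ}
    (ht : 0 ≤ t) : Summable fun k : ℕ => (p k).toReal * ((k : ℝ) * min 1 (k * t)) := by
  refine Summable.of_nonneg_of_le (fun k => by positivity) (fun k => ?_) hμ.summable
  exact mul_le_mul_of_nonneg_left
    (mul_le_of_le_one_right (Nat.cast_nonneg k) (min_le_left _ _)) ENNReal.toReal_nonneg

lemma deviation_nonneg {t : ℝ} (ht : 0 ≤ t) : 0 ≤ deviation p t :=
  tsum_nonneg fun k => by positivity

lemma deviation_mono (hμ : HasSum (fun i : ℕ => (p i).toReal * (i : ℝ)) μ) {s t : ℝ}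
    (hs : 0 ≤ s) (hst : s ≤ t) : deviation p s ≤ deviation p t :=
  (summable_deviation hμ hs).tsum_le_tsum (fun k => by gcongr) (summable_deviation hμ (hs.trans hst))

lemma one_sub_mul_le_pow (k : ℕ) {t : ℝ} (ht1 : t ≤ 1) : 1 - k * t ≤ (1 - t) ^ k := by
  have := one_add_mul_le_pow (a := -t) (by linarith) k
  simpa [sub_eq_add_neg] using this

lemma pow_one_sub_le (k : ℕ) {t : ℝ} (ht : 0 ≤ t) (ht1 : t ≤ 1) :
    (1 - t) ^ k ≤ 1 - k * t + k * t * min 1 (k * t) := by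
  have hp : (1 - t) ^ k ≤ 1 := pow_le_one₀ (by linarith) (by linarith)
  rcases le_total 1 ((k : ℝ) * t) with h | h
  · rw [min_eq_left h]; linarith
  · rw [min_eq_right h]
    -- The quadratic bound `(1 - t)^k ≤ 1 - kt + (kt)²` holds for every `k`, so the induction drops
    -- the case assumption `kt ≤ 1`.
    clear hp h
    induction k with
    | zero => simp
    | succ k ih =>
      have h0 : 0 ≤ (k : ℝ) := Nat.cast_nonneg k
      rw [pow_succ]
      push_cast
      nlinarith [mul_nonneg h0 ht, mul_nonneg (mul_nonneg h0 ht) ht,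
        mul_nonneg (mul_nonneg (mul_nonneg h0 h0) (mul_nonneg ht ht)) ht, mul_self_nonneg t,
        mul_le_mul_of_nonneg_right ih (sub_nonneg.2 ht1)]

lemma hasSum_toReal (p : PMF ℕ) : HasSum (fun k => (p k).toReal) 1 := by
  have := ENNReal.hasSum_toReal (f := p) (by rw [p.tsum_coe]; simp)
  rwa [← ENNReal.tsum_toReal_eq p.apply_ne_top, p.tsum_coe, ENNReal.toReal_one] at this

lemma hasSum_one_sub_pgf {t : ℝ} (ht : 0 ≤ t) (ht1 : t ≤ 1) :
    HasSum (fun k : ℕ => (p k).toReal * (1 - (1 - t) ^ k)) (1 - pgf p (1 - t)) := by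
  have h := (hasSum_toReal p).sub (hasSum_pgf (𝕜 := ℝ) p (z := 1 - t)
    (by rw [Real.norm_eq_abs, abs_of_nonneg] <;> linarith))
  refine h.congr_fun fun k => ?_
  simp only [RCLike.ofReal_real_eq_id, id]
  ring

lemma one_sub_pgf_le (hμ : HasSum (fun i : ℕ => (p i).toReal * (i : ℝ)) μ) {t : ℝ}
    (ht : 0 ≤ t) (ht1 : t ≤ 1) : 1 - pgf p (1 - t) ≤ μ * t := by
  refine hasSum_le (fun k => ?_) (hasSum_one_sub_pgf ht ht1) (hμ.mul_right t)
  have := one_sub_mul_le_pow k ht1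
  rw [mul_assoc]
  exact mul_le_mul_of_nonneg_left (by linarith) ENNReal.toReal_nonneg

lemma le_one_sub_pgf (hμ : HasSum (fun i : ℕ => (p i).toReal * (i : ℝ)) μ) {t : ℝ}
    (ht : 0 ≤ t) (ht1 : t ≤ 1) : μ * t - t * deviation p t ≤ 1 - pgf p (1 - t) := by
  refine hasSum_le (fun k => ?_)
    ((hμ.mul_right t).sub ((summable_deviation hμ ht).hasSum.mul_left t))
    (hasSum_one_sub_pgf ht ht1)
  have h := pow_one_sub_le k ht ht1
  have : (p k).toReal * k * t - t * ((p k).toReal * (k * min 1 (k * t)))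
      = (p k).toReal * (k * t - k * t * min 1 (k * t)) := by ring
  rw [this]
  exact mul_le_mul_of_nonneg_left (by linarith) ENNReal.toReal_nonneg

lemma pgf_mem_Icc {z : ℝ} (hz : z ∈ Set.Icc (0 : ℝ) 1) : pgf p z ∈ Set.Icc (0 : ℝ) 1 := by
  refine ⟨integral_nonneg fun k => pow_nonneg hz.1 k, ?_⟩
  have := norm_pgf_le p (z := z) (by rw [Real.norm_of_nonneg hz.1]; exact hz.2)
  exact (le_abs_self _).trans this

/-- The terms are at most `1` up to `i ≈ log k / log μ`, and from there on they are dominated by a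
geometric series. This is where the logarithm enters. -/
lemma summable_min_geometric (hμ1 : 1 < μ) (k : ℕ) (hk : 1 ≤ k) :
    Summable (fun i : ℕ => min 1 ((k : ℝ) * μ⁻¹ ^ i)) ∧
    ∑' i : ℕ, min 1 ((k : ℝ) * μ⁻¹ ^ i) ≤ Real.log k / Real.log μ + 1 + (1 - μ⁻¹)⁻¹ := by
  have hμ0 : 0 < μ := by linarith
  have hr1 : μ⁻¹ < 1 := inv_lt_one_of_one_lt₀ hμ1
  have hr0 : 0 ≤ μ⁻¹ := by positivity
  have hgeo := summable_geometric_of_lt_one hr0 hr1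
  have hs : Summable (fun i : ℕ => min 1 ((k : ℝ) * μ⁻¹ ^ i)) :=
    Summable.of_nonneg_of_le (fun i => by positivity) (fun i => min_le_right _ _)
      (hgeo.mul_left (k : ℝ))
  refine ⟨hs, ?_⟩
  have hk0 : (0 : ℝ) < k := by exact_mod_cast hk
  have hlogμ : 0 < Real.log μ := Real.log_pos hμ1
  have hlogk : 0 ≤ Real.log k := Real.log_natCast_nonneg k
  set l := ⌈Real.log k / Real.log μ⌉₊ with hl
  have hl1 : (l : ℝ) ≤ Real.log k / Real.log μ + 1 := (Nat.ceil_lt_add_one (by positivity)).le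
  have hl2 : (k : ℝ) ≤ μ ^ l := by
    rw [← Real.log_le_log_iff hk0 (by positivity), Real.log_pow]
    exact (div_le_iff₀ hlogμ).1 (Nat.le_ceil _)
  rw [← hs.sum_add_tsum_nat_add l]
  refine add_le_add ?_ ?_
  · refine le_trans ?_ hl1
    calc ∑ i ∈ Finset.range l, min 1 ((k : ℝ) * μ⁻¹ ^ i) ≤ ∑ i ∈ Finset.range l, (1 : ℝ) :=
          Finset.sum_le_sum fun i _ => min_le_left _ _
      _ = l := by simp
  · rw [← tsum_geometric_of_lt_one hr0 hr1]
    refine Summable.tsum_le_tsum (fun i => ?_) ((summable_nat_add_iff l).2 hs) hgeo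
    refine (min_le_right _ _).trans ?_
    rw [pow_add, mul_comm (μ⁻¹ ^ i), ← mul_assoc]
    refine mul_le_of_le_one_left (by positivity) ?_
    rw [inv_pow, ← div_eq_mul_inv]
    exact (div_le_one (by positivity)).2 hl2

/-- Exchange the two summations: the inner sum over `i` costs a factor of order `1 + log k`, and `∑
pₖ k (1 + log k)` is finite by hypothesis. -/
lemma summable_deviation_geometric (hμ : HasSum (fun i : ℕ => (p i).toReal * (i : ℝ)) μ)
    (hμ1 : 1 < μ) (hlog : Summable (fun i : ℕ => (p i).toReal * ((i : ℝ) * Real.log i))) :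
    Summable (fun i : ℕ => deviation p (μ⁻¹ ^ i)) := by
  have hr0 : 0 ≤ μ⁻¹ := by positivity
  have hfac : ∀ k : ℕ, (fun i : ℕ => (p k).toReal * ((k : ℝ) * min 1 (k * μ⁻¹ ^ i)))
      = fun i : ℕ => ((p k).toReal * k) * min 1 (k * μ⁻¹ ^ i) := fun k => by
    funext i; ring
  have hsum : ∀ k : ℕ, Summable (fun i : ℕ => (p k).toReal * ((k : ℝ) * min 1 (k * μ⁻¹ ^ i))) := by
    intro k
    rw [hfac]
    rcases Nat.eq_zero_or_pos k with rfl | hk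
    · simp
    · exact (summable_min_geometric hμ1 k hk).1.mul_left _
  have h : Summable (fun q : ℕ × ℕ => (p q.1).toReal * ((q.1 : ℝ) * min 1 (q.1 * μ⁻¹ ^ q.2))) := by
    refine (summable_prod_of_nonneg fun q => by positivity).2 ⟨hsum, ?_⟩
    refine Summable.of_nonneg_of_le (fun k => tsum_nonneg fun i => by positivity) (fun k => ?_)
      ((hlog.div_const (Real.log μ)).add (hμ.summable.mul_right (1 + (1 - μ⁻¹)⁻¹)))
    rcases Nat.eq_zero_or_pos k with rfl | hk
    · simp
    · simp only
      rw [hfac, tsum_mul_left]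
      refine (mul_le_mul_of_nonneg_left (summable_min_geometric hμ1 k hk).2
        (by positivity)).trans_eq ?_
      ring
  exact h.prod_symm.prod

/-- Under the `x log x` condition the Laplace transforms of `μ⁻ⁿ Zₙ` stay away from `1`. -/
lemma exists_pgf_iterate_le (hμ : HasSum (fun i : ℕ => (p i).toReal * (i : ℝ)) μ)
    (hμ1 : 1 < μ) (hlog : Summable (fun i : ℕ => (p i).toReal * ((i : ℝ) * Real.log i))) :
    ∃ c > 0, ∃ ε > 0, ∀ n : ℕ, (pgf p)^[n] (Real.exp (-(c / μ ^ n))) ≤ 1 - ε := by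
  have hμ0 : 0 < μ := by linarith
  have hr0 : 0 < μ⁻¹ := by positivity
  have hr1 : μ⁻¹ < 1 := inv_lt_one_of_one_lt₀ hμ1
  have hS := summable_deviation_geometric hμ hμ1 hlog
  -- Starting at scale `μ⁻ᵐ` leaves a total relative loss below `1/2`. The `1/4` in `ε` combines
  -- this factor with the estimate `1 - exp(-u) ≥ u/2`.
  obtain ⟨m, hm⟩ := ((tendsto_order.1 (tendsto_sum_nat_add fun i => deviation p (μ⁻¹ ^ i))).2
    (μ / 2) (by positivity)).exists
  have hnn : ∀ i : ℕ, 0 ≤ deviation p (μ⁻¹ ^ i) := fun i => deviation_nonneg (by positivity)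
  refine ⟨μ⁻¹ ^ m, by positivity, μ⁻¹ ^ m / 4, by positivity, fun n => ?_⟩
  set u : ℝ := μ⁻¹ ^ m / μ ^ n with hu
  have hu0 : 0 < u := by positivity
  have hu1 : u ≤ 1 := by
    rw [hu, div_eq_mul_inv, ← inv_pow, ← pow_add]
    exact pow_le_one₀ hr0.le hr1.le
  set t : ℕ → ℝ := fun j => 1 - (pgf p)^[j] (Real.exp (-u)) with ht
  have hmem : ∀ j, (pgf p)^[j] (Real.exp (-u)) ∈ Set.Icc (0 : ℝ) 1 := by
    intro j
    induction j with
    | zero => exact ⟨(Real.exp_pos _).le, Real.exp_le_one_iff.2 (by linarith)⟩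
    | succ j ih => rw [Function.iterate_succ_apply']; exact pgf_mem_Icc ih
  have ht0 : ∀ j, 0 ≤ t j := fun j => sub_nonneg.2 (hmem j).2
  have ht1 : ∀ j, t j ≤ 1 := fun j => by have := (hmem j).1; simp only [ht]; linarith
  have hstep : ∀ j, t (j + 1) = 1 - pgf p (1 - t j) := fun j => by
    simp only [ht, Function.iterate_succ_apply', sub_sub_cancel]
  have htu : t 0 ≤ u := by
    have := Real.add_one_le_exp (-u)
    simp only [ht, Function.iterate_zero, id]
    linarith
  have hup : ∀ j, t j ≤ μ ^ j * t 0 := by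
    intro j
    induction j with
    | zero => simp
    | succ j ih =>
      rw [hstep, pow_succ, mul_comm (μ ^ j), mul_assoc]
      exact (one_sub_pgf_le hμ (ht0 j) (ht1 j)).trans (by gcongr)
  have hup' : ∀ j ≤ n, t j ≤ μ⁻¹ ^ (m + (n - j)) := by
    intro j hj
    calc t j ≤ μ ^ j * u := (hup j).trans (by gcongr)
      _ = μ⁻¹ ^ (m + (n - j)) := by
        obtain ⟨d, rfl⟩ := Nat.exists_eq_add_of_le hj
        rw [hu, Nat.add_sub_cancel_left, pow_add, pow_add, inv_pow, inv_pow]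
        field_simp
  -- Linear growth by `μ` per step, with the relative losses summed instead of multiplied; the upper
  -- bounds `hup` and `hup'` control the loss at each step.
  have hlow : ∀ j ≤ n, μ ^ j * t 0
      * (1 - (∑ i ∈ Finset.range j, deviation p (μ⁻¹ ^ (m + (n - i)))) / μ) ≤ t j := by
    intro j
    induction j with
    | zero => intro _; simp
    | succ j ih =>
      intro hj
      have h1 := ih (by omega)
      have h2 := le_one_sub_pgf hμ (ht0 j) (ht1 j)
      rw [← hstep] at h2
      have h3 := deviation_mono hμ (ht0 j) (hup' j (by omega))
      have h4 : t j * deviation p (t j)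
          ≤ μ ^ j * t 0 * deviation p (μ⁻¹ ^ (m + (n - j))) :=
        mul_le_mul (hup j) h3 (deviation_nonneg (ht0 j)) (mul_nonneg (by positivity) (ht0 0))
      rw [Finset.sum_range_succ]
      have h5 := mul_le_mul_of_nonneg_left h1 hμ0.le
      refine le_trans (le_of_eq ?_) ((sub_le_sub h5 h4).trans h2)
      field_simp
      ring
  have hsum : ∑ i ∈ Finset.range n, deviation p (μ⁻¹ ^ (m + (n - i))) ≤ μ / 2 := by
    have e : ∑ i ∈ Finset.range n, deviation p (μ⁻¹ ^ (m + (n - i)))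
        = ∑ i ∈ Finset.range n, deviation p (μ⁻¹ ^ (i + 1 + m)) := by
      rw [← Finset.sum_range_reflect]
      refine Finset.sum_congr rfl fun i hi => ?_
      have := Finset.mem_range.1 hi
      congr 2
      omega
    have hS' : Summable fun i => deviation p (μ⁻¹ ^ (i + m)) := (summable_nat_add_iff m).2 hS
    have h1 := hS'.sum_le_tsum (Finset.range (n + 1)) fun i _ => hnn _
    rw [Finset.sum_range_succ'] at h1
    have := hnn (0 + m)
    rw [e]
    linarith
  have hfin : μ ^ n * t 0 * (1 / 2) ≤ t n := by
    refine le_trans (mul_le_mul_of_nonneg_left ?_ (mul_nonneg (by positivity) (ht0 0)))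
      (hlow n le_rfl)
    have : (∑ i ∈ Finset.range n, deviation p (μ⁻¹ ^ (m + (n - i)))) / μ ≤ 1 / 2 := by
      rw [div_le_iff₀ hμ0]; linarith
    linarith
  have htl : u / 2 ≤ t 0 := by
    have h1 : Real.exp (-u) ≤ 1 - u / 2 := by
      have h := Real.add_one_le_exp u
      rw [Real.exp_neg]
      refine (inv_anti₀ (by linarith) h).trans ?_
      rw [inv_le_iff_one_le_mul₀ (by linarith)]
      nlinarith
    simp only [ht, Function.iterate_zero, id]
    linarith
  have hun : μ ^ n * u = μ⁻¹ ^ m := by rw [hu]; field_simp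
  have hlast : μ ^ n * (u / 2) ≤ μ ^ n * t 0 := by gcongr
  have : t n = 1 - (pgf p)^[n] (Real.exp (-u)) := rfl
  linarith

end KestenStigum

/-! ### Absence of atoms for fixed points of the branching equation -/

section ConvPow

/-- The `k`-fold convolution power of a measure on the real line. -/
noncomputable def convPow (ν : Measure ℝ) : ℕ → Measure ℝ
  | 0 => Measure.dirac 0
  | k + 1 => convPow ν k ∗ ν

/-- The law of a sum of `K` independent variables with law `ν`, where `K` has the law `p` and is
independent of the summands. -/
noncomputable def compound (p : PMF ℕ) (ν : Measure ℝ) : Measure ℝ :=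
  Measure.sum fun k => p k • convPow ν k

variable {ν : Measure ℝ} [IsProbabilityMeasure ν] {p : PMF ℕ}

instance isProbabilityMeasure_convPow (k : ℕ) : IsProbabilityMeasure (convPow ν k) := by
  induction k with
  | zero => unfold convPow; infer_instance
  | succ k ih => unfold convPow; infer_instance

instance isProbabilityMeasure_compound : IsProbabilityMeasure (compound p ν) where
  measure_univ := by
    rw [compound, Measure.sum_apply _ MeasurableSet.univ]
    simp [p.tsum_coe]

lemma charFun_convPow (k : ℕ) (t : ℝ) : charFun (convPow ν k) t = charFun ν t ^ k := by
  induction k with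
  | zero => simp [convPow]
  | succ k ih => rw [convPow, charFun_conv, ih, pow_succ]

lemma charFun_compound (t : ℝ) : charFun (compound p ν) t = pgf p (charFun ν t) := by
  have hint : Integrable (fun x : ℝ => Complex.exp (t * x * Complex.I)) (compound p ν) := by
    refine Integrable.of_bound (by fun_prop) 1 (ae_of_all _ fun x => ?_)
    rw [← Complex.ofReal_mul, Complex.norm_exp_ofReal_mul_I]
  have h := hasSum_integral_measure (μ := fun k => p k • convPow ν k) hint
  have h2 : ∀ k, ∫ x : ℝ, Complex.exp (t * x * Complex.I) ∂(p k • convPow ν k)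
      = ((p k).toReal : ℂ) * charFun ν t ^ k := fun k => by
    rw [integral_smul_measure, ← charFun_apply_real, charFun_convPow, Complex.real_smul]
  simp only [h2] at h
  rw [charFun_apply_real]
  exact h.unique (hasSum_pgf p (norm_charFun_le_one t))

lemma convPow_succ_apply (k : ℕ) {S : Set ℝ} (hS : MeasurableSet S) :
    convPow ν (k + 1) S = ∫⁻ z, ν ((fun y => z + y) ⁻¹' S) ∂(convPow ν k) := by
  rw [convPow, ← lintegral_indicator_one hS, Measure.lintegral_conv
    (measurable_one.indicator hS)]
  refine lintegral_congr fun z => ?_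
  have : MeasurableSet ((fun y => z + y) ⁻¹' S) := measurable_const_add z hS
  rw [← lintegral_indicator_one this]
  rfl

lemma convPow_succ_singleton (k : ℕ) (y : ℝ) :
    convPow ν (k + 1) {y} = ∫⁻ z, ν {y - z} ∂(convPow ν k) := by
  rw [convPow_succ_apply k (measurableSet_singleton y)]
  refine lintegral_congr fun z => ?_
  congr 1
  ext x
  simp only [Set.mem_preimage, Set.mem_singleton_iff]
  constructor <;> intro h <;> linarith

lemma measurable_measure_singleton_sub (y : ℝ) : Measurable fun z => ν {y - z} := by
  have := measurable_measure_prodMk_left (ν := ν) (s := {q : ℝ × ℝ | q.1 + q.2 = y})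
    (measurableSet_eq_fun (by fun_prop) (by fun_prop))
  convert this using 3 with z
  ext x
  simp only [Set.mem_singleton_iff, Set.mem_preimage, Set.mem_ofPred_eq]
  constructor <;> intro h <;> linarith

/-- Fix the sum of the first `k` summands at a typical value: the last summand then lies in a
translate of `F`. -/
lemma exists_finite_of_convPow {k : ℕ} {F : Set ℝ} (hF : F.Finite)
    (h : convPow ν (k + 1) Fᶜ = 0) : ∃ G : Set ℝ, G.Finite ∧ ν Gᶜ = 0 := by
  have hm : Measurable fun z => ν ((fun y => z + y) ⁻¹' Fᶜ) :=
    measurable_measure_prodMk_left (ν := ν) (s := {q : ℝ × ℝ | q.1 + q.2 ∈ Fᶜ})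
      ((measurable_fst.add measurable_snd) hF.measurableSet.compl)
  rw [convPow_succ_apply k hF.measurableSet.compl, lintegral_eq_zero_iff hm] at h
  obtain ⟨z, hz⟩ := h.exists
  exact ⟨(fun y => z + y) ⁻¹' F, hF.preimage (add_right_injective z).injOn, hz⟩

/-- All `k` independent summands may equal `w`. -/
lemma pow_le_convPow_singleton (k : ℕ) (w : ℝ) : ν {w} ^ k ≤ convPow ν k {k * w} := by
  induction k with
  | zero => simp [convPow]
  | succ k ih =>
    rw [convPow_succ_singleton, pow_succ]
    calc ν {w} ^ k * ν {w} ≤ convPow ν k {k * w} * ν {w} := by gcongr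
      _ = ∫⁻ z in {k * w}, ν {((k + 1 : ℕ) : ℝ) * w - z} ∂(convPow ν k) := by
        rw [lintegral_singleton, mul_comm]
        congr 3
        push_cast
        ring
      _ ≤ _ := setLIntegral_le_lintegral _ _

/-- Only finitely many atoms can have mass at least a given `c > 0`, so the largest mass is
attained, and at finitely many points. -/
lemma exists_max_atom (h : ∃ x, ν {x} ≠ 0) :
    ∃ x, ν {x} ≠ 0 ∧ (∀ y, ν {y} ≤ ν {x}) ∧ {y | ν {y} = ν {x}}.Finite := by
  obtain ⟨x₁, hx₁⟩ := h
  have hfin : ∀ c : ENNReal, c ≠ 0 → {y | c ≤ ν {y}}.Finite := fun c hc =>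
    Measure.finite_const_le_meas_of_disjoint_iUnion ν (pos_iff_ne_zero.2 hc)
      (fun y => measurableSet_singleton y)
      (fun i j hij => by simpa using hij) (measure_ne_top _ _)
  obtain ⟨x, hx, hmax⟩ := (hfin _ hx₁).exists_maximalFor (fun y => ν {y}) _
    ⟨x₁, (le_refl (ν {x₁}) :)⟩
  have hx0 : ν {x} ≠ 0 := fun h0 => hx₁ (le_antisymm (h0 ▸ hx) bot_le)
  refine ⟨x, hx0, fun y => ?_, (hfin _ hx0).subset fun y hy => hy.ge⟩
  rcases le_total (ν {y}) (ν {x}) with h | h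
  · exact h
  · exact hmax (hx.trans h) h

/-- If a probability measure on `[0, ∞)` is mapped by `x ↦ μ x` to its compound and is not the
point mass at `0`, then it has no atoms. -/
theorem measure_singleton_eq_zero_of_map_eq_compound (hp0 : p 0 = 0) {μ : ℝ} (hμ1 : 1 < μ)
    (hfix : ν.map (fun x => μ * x) = compound p ν) (hnn : ν (Set.Iio 0) = 0)
    (h0 : ν {0}ᶜ ≠ 0) {k : ℕ} (hk : μ < k) (hpk : p k ≠ 0) (x : ℝ) : ν {x} = 0 := by
  by_contra hx
  have hμ0 : 0 < μ := by linarith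
  obtain ⟨x₀, hx₀, hmax, hfin⟩ := exists_max_atom ⟨x, hx⟩
  have hscale : ∀ y, compound p ν {y} = ν {y / μ} := fun y => by
    rw [← hfix, Measure.map_apply (measurable_const_mul μ) (measurableSet_singleton y)]
    congr 1
    ext z
    simp only [Set.mem_preimage, Set.mem_singleton_iff]
    rw [eq_div_iff hμ0.ne', mul_comm]
  have hsum : ∀ y, compound p ν {y} = ∑' k, p k * convPow ν k {y} := fun y => by
    rw [compound, Measure.sum_apply _ (measurableSet_singleton y)]
    rfl
  -- Convolution with a probability measure cannot increase the largest atom.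
  have hle : ∀ (k : ℕ) (y : ℝ), convPow ν (k + 1) {y} ≤ ν {x₀} := fun k y => by
    rw [convPow_succ_singleton]
    refine (lintegral_mono fun z => hmax _).trans ?_
    simp
  obtain ⟨j, rfl⟩ : ∃ j, k = j + 2 := by
    have : (1 : ℝ) < k := hμ1.trans hk
    have : 1 < k := by exact_mod_cast this
    exact ⟨k - 2, by omega⟩
  -- By the fixed-point equation the maximal mass is a `p`-average of quantities bounded by it, so
  -- every index of positive weight attains it. The index `0`, whose point mass escapes the bound,
  -- has weight zero.
  have heq : convPow ν (j + 2) {μ * x₀} = ν {x₀} := by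
    refine le_antisymm (hle _ _) ?_
    by_contra hlt
    rw [not_le] at hlt
    have h1 : ∑' k, p k * convPow ν k {μ * x₀} < ∑' k, p k * ν {x₀} := by
      refine ENNReal.tsum_lt_tsum (i := j + 2) ?_ (fun k => ?_) ?_
      · rw [← hsum]; exact measure_ne_top _ _
      · rcases k with _ | k
        · simp [hp0]
        · exact mul_le_mul' le_rfl (hle k _)
      · exact (ENNReal.mul_lt_mul_iff_right hpk (p.apply_ne_top _)).2 hlt
    rw [ENNReal.tsum_mul_right, p.tsum_coe, one_mul, ← hsum, hscale,
      mul_div_cancel_left₀ _ hμ0.ne'] at h1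
    exact lt_irrefl _ h1
  have hae : convPow ν (j + 1) {z | ν {μ * x₀ - z} = ν {x₀}}ᶜ = 0 := by
    have h1 : ∫⁻ z, (ν {x₀} - ν {μ * x₀ - z}) ∂(convPow ν (j + 1)) = 0 := by
      rw [lintegral_sub (measurable_measure_singleton_sub _)]
      · rw [← convPow_succ_singleton, heq]
        simp
      · rw [← convPow_succ_singleton, heq]
        exact measure_ne_top _ _
      · exact ae_of_all _ fun z => hmax _
    rw [lintegral_eq_zero_iff ((measurable_measure_singleton_sub _).const_sub _)] at h1
    refine measure_mono_null (fun z hz => ?_) (ae_iff.1 h1)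
    simp only [Set.mem_compl_iff, Set.mem_ofPred_eq, Pi.zero_apply, tsub_eq_zero_iff_le] at hz ⊢
    exact fun h => hz (le_antisymm (hmax _) h)
  obtain ⟨G, hG, hGν⟩ := exists_finite_of_convPow
    (hfin.preimage (sub_right_injective (b := μ * x₀)).injOn) hae
  have hatom : ∀ y, ν {y} ≠ 0 → y ∈ G := fun y hy => by
    by_contra hyG
    exact hy (measure_mono_null (Set.singleton_subset_iff.2 hyG) hGν)
  obtain ⟨y, hy0, hy⟩ : ∃ y, y ≠ 0 ∧ ν {y} ≠ 0 := by
    by_contra! hc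
    refine h0 (measure_mono_null (t := Gᶜ ∪ ⋃ y ∈ G \ {0}, {y}) (fun y hy => ?_) ?_)
    · by_cases hyG : y ∈ G
      · exact Or.inr (by simpa using ⟨hyG, hy⟩)
      · exact Or.inl hyG
    · refine measure_union_null hGν ((measure_biUnion_null_iff (hG.sdiff).countable).2 ?_)
      exact fun y hy => hc y hy.2
  have hypos : 0 < y := by
    refine lt_of_le_of_ne (not_lt.1 fun hlt => hy ?_) hy0.symm
    exact measure_mono_null (Set.singleton_subset_iff.2 hlt) hnn
  have hGa : {y | ν {y} ≠ 0}.Finite := hG.subset hatom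
  -- Contradiction at the largest atom `w > 0`: with `k = j + 2 > μ` summands all equal to `w`, the
  -- point `k w / μ > w` is an atom too.
  obtain ⟨w, hw, hwmax⟩ := hGa.exists_maximalFor id _ ⟨y, hy⟩
  have hwy : y ≤ w := by
    rcases le_total y w with h | h
    · exact h
    · exact hwmax hy h
  have hw0 : 0 < w := hypos.trans_le hwy
  have hbig : ν {((j + 2 : ℕ) : ℝ) * w / μ} ≠ 0 := by
    rw [← hscale, hsum]
    intro h
    have h1 := ENNReal.tsum_eq_zero.1 h (j + 2)
    have h2 : convPow ν (j + 2) {((j + 2 : ℕ) : ℝ) * w} = 0 := (mul_eq_zero.1 h1).resolve_left hpk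
    have h3 := pow_le_convPow_singleton (ν := ν) (j + 2) w
    rw [h2] at h3
    exact hw (pow_eq_zero_iff (by omega) |>.1 (le_antisymm h3 bot_le))
  have hgt : w < ((j + 2 : ℕ) : ℝ) * w / μ := by
    rw [lt_div_iff₀ hμ0, mul_comm]
    exact mul_lt_mul_of_pos_right hk hw0
  exact absurd (hwmax hbig hgt.le) (not_le.2 hgt)

end ConvPow

/-! ### The law of `Z_∞` and convergence of tail probabilities -/

section Limit

variable {Ω : Type*} [MeasurableSpace Ω] {P : Measure Ω} {p : PMF ℕ}
  {X : ℕ → ℕ → Ω → ℕ} {μ : ℝ}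

lemma IsIIDArray.measurable_gw (hX : IsIIDArray X p P) (n : ℕ) :
    Measurable (fun ω => galtonWatson (fun k i => X k i ω) n) :=
  measurable_galtonWatson fun k _ i => hX.measurable k i

lemma IsIIDArray.measurable_gw_div (hX : IsIIDArray X p P) (n : ℕ) :
    Measurable (fun ω => (galtonWatson (fun k i => X k i ω) n : ℝ) / μ ^ n) :=
  ((measurable_from_top (f := fun k : ℕ => (k : ℝ))).comp (hX.measurable_gw n)).div_const _

lemma IsIIDArray.gw_div_eq_one (hX : IsIIDArray X p P) (hμ1 : 1 < μ) {m : ℕ} (hm : (m : ℝ) = μ)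
    (h : ∀ k ≠ m, p k = 0) :
    ∀ᵐ ω ∂P, ∀ n, (galtonWatson (fun k i => X k i ω) n : ℝ) / μ ^ n = 1 := by
  have hXm : ∀ᵐ ω ∂P, ∀ n i, X n i ω = m := by
    refine ae_all_iff.2 fun n => ae_all_iff.2 fun i => ?_
    have h0 : P (X n i ⁻¹' {m}ᶜ) = 0 := by
      rw [← Measure.map_apply (hX.measurable n i) (measurableSet_singleton m).compl, hX.law,
        PMF.toMeasure_apply_eq_zero_iff _ (measurableSet_singleton m).compl]
      exact Set.disjoint_left.2 fun k hk hkm => hk (h k hkm)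
    filter_upwards [measure_eq_zero_iff_ae_notMem.1 h0] with ω hω
    simpa using hω
  filter_upwards [hXm] with ω hω n
  simp only [hω, galtonWatson_const]
  push_cast
  rw [hm, div_self (by positivity)]

variable [IsProbabilityMeasure P]

lemma IsIIDArray.aemeasurable_gwLimit (hX : IsIIDArray X p P)
    (hμ : HasSum (fun i : ℕ => (p i).toReal * (i : ℝ)) μ) (hμ1 : 1 < μ) :
    AEMeasurable (fun ω => gwLimit μ (fun m i => X m i ω)) P :=
  aemeasurable_of_tendsto_metrizable_ae atTop (fun n => (hX.measurable_gw_div n).aemeasurable)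
    (hX.ae_tendsto_gwLimit hμ hμ1)

lemma IsIIDArray.gwLimit_nonneg (hX : IsIIDArray X p P)
    (hμ : HasSum (fun i : ℕ => (p i).toReal * (i : ℝ)) μ) (hμ1 : 1 < μ) :
    ∀ᵐ ω ∂P, 0 ≤ gwLimit μ (fun m i => X m i ω) := by
  filter_upwards [hX.ae_tendsto_gwLimit hμ hμ1] with ω hω
  exact ge_of_tendsto' hω fun n => by positivity

lemma IsIIDArray.tendsto_pgf_iterate_charFun (hX : IsIIDArray X p P)
    (hμ : HasSum (fun i : ℕ => (p i).toReal * (i : ℝ)) μ) (hμ1 : 1 < μ) (t : ℝ) :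
    Tendsto (fun n : ℕ => (pgf p)^[n] (Complex.exp (((t / μ ^ n : ℝ) : ℂ) * Complex.I))) atTop
      (𝓝 (charFun (P.map fun ω => gwLimit μ (fun m i => X m i ω)) t)) := by
  rw [charFun_apply_real, integral_map (hX.aemeasurable_gwLimit hμ hμ1) (by fun_prop)]
  have h : ∀ n : ℕ, (pgf p)^[n] (Complex.exp (((t / μ ^ n : ℝ) : ℂ) * Complex.I))
      = ∫ ω, Complex.exp (t * (((galtonWatson (fun k i => X k i ω) n : ℝ) / μ ^ n : ℝ) : ℂ)
          * Complex.I) ∂P := fun n => by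
    rw [← hX.integral_pow_galtonWatson n (Complex.norm_exp_ofReal_mul_I _).le]
    refine integral_congr_ae (ae_of_all _ fun ω => ?_)
    simp only
    rw [← Complex.exp_nat_mul]
    congr 1
    push_cast
    ring
  simp only [h]
  refine tendsto_integral_of_dominated_convergence (fun _ => 1) (fun n => ?_)
    (integrable_const _) (fun n => ae_of_all _ fun ω => ?_) ?_
  · have := hX.measurable_gw_div (μ := μ) n
    exact Measurable.aestronglyMeasurable (by fun_prop)
  · rw [← Complex.ofReal_mul, Complex.norm_exp_ofReal_mul_I]
  · filter_upwards [hX.ae_tendsto_gwLimit hμ hμ1] with ω hω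
    have hc : Continuous fun x : ℝ => Complex.exp (t * x * Complex.I) := by fun_prop
    exact (hc.tendsto _).comp hω

/-- Let `n → ∞` in the iteration of the generating function: the characteristic function `φ` of the
limit satisfies `φ(μt) = pgf p (φ(t))`. -/
lemma IsIIDArray.map_mul_gwLimit (hX : IsIIDArray X p P)
    (hμ : HasSum (fun i : ℕ => (p i).toReal * (i : ℝ)) μ) (hμ1 : 1 < μ) :
    (P.map fun ω => gwLimit μ (fun m i => X m i ω)).map (fun x => μ * x)
      = compound p (P.map fun ω => gwLimit μ (fun m i => X m i ω)) := by
  have hW := hX.aemeasurable_gwLimit hμ hμ1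
  have : IsProbabilityMeasure (P.map fun ω => gwLimit μ (fun m i => X m i ω)) :=
    Measure.isProbabilityMeasure_map hW
  have : IsProbabilityMeasure
      ((P.map fun ω => gwLimit μ (fun m i => X m i ω)).map (fun x => μ * x)) :=
    Measure.isProbabilityMeasure_map (by fun_prop)
  refine Measure.ext_of_charFun (funext fun t => ?_)
  rw [charFun_map_mul, charFun_compound]
  have h1 := (tendsto_add_atTop_iff_nat 1).2 (hX.tendsto_pgf_iterate_charFun hμ hμ1 (μ * t))
  have hn : ∀ n, ‖(pgf p)^[n] (Complex.exp (((t / μ ^ n : ℝ) : ℂ) * Complex.I))‖ ≤ 1 := by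
    intro n
    have : ∀ (n : ℕ) (z : ℂ), ‖z‖ ≤ 1 → ‖(pgf p)^[n] z‖ ≤ 1 := by
      intro n
      induction n with
      | zero => exact fun z hz => hz
      | succ n ih => exact fun z hz => ih _ (norm_pgf_le p hz)
    exact this n _ (Complex.norm_exp_ofReal_mul_I _).le
  have h2 := tendsto_pgf p hn (hX.tendsto_pgf_iterate_charFun hμ hμ1 t)
  refine tendsto_nhds_unique (h1.congr fun n => ?_) h2
  rw [Function.iterate_succ_apply', pow_succ, mul_comm (μ ^ n) μ,
    mul_div_mul_left _ _ (by linarith : μ ≠ 0)]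

/-- A zero limit would send the Laplace transforms of `μ⁻ⁿ Zₙ` to `1`, against the uniform bound `1
- ε`. -/
lemma IsIIDArray.map_gwLimit_ne_zero (hX : IsIIDArray X p P)
    (hμ : HasSum (fun i : ℕ => (p i).toReal * (i : ℝ)) μ) (hμ1 : 1 < μ)
    (hlog : Summable (fun i : ℕ => (p i).toReal * ((i : ℝ) * Real.log i))) :
    ¬ ∀ᵐ ω ∂P, gwLimit μ (fun m i => X m i ω) = 0 := by
  intro h0
  obtain ⟨c, hc, ε, hε, hle⟩ := exists_pgf_iterate_le hμ hμ1 hlog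
  have h : ∀ n : ℕ, (pgf p)^[n] (Real.exp (-(c / μ ^ n)))
      = ∫ ω, Real.exp (-(c * ((galtonWatson (fun k i => X k i ω) n : ℝ) / μ ^ n))) ∂P := fun n => by
    rw [← hX.integral_pow_galtonWatson n]
    · refine integral_congr_ae (ae_of_all _ fun ω => ?_)
      simp only
      rw [← Real.exp_nat_mul]
      congr 1
      ring
    · rw [Real.norm_of_nonneg (Real.exp_pos _).le, Real.exp_le_one_iff, neg_nonpos]
      positivity
  have hlim : Tendsto (fun n : ℕ => (pgf p)^[n] (Real.exp (-(c / μ ^ n)))) atTop (𝓝 1) := by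
    simp only [h]
    rw [show (1 : ℝ) = ∫ _, (1 : ℝ) ∂P by simp]
    refine tendsto_integral_of_dominated_convergence (fun _ => 1) (fun n => ?_)
      (integrable_const _) (fun n => ae_of_all _ fun ω => ?_) ?_
    · have := hX.measurable_gw_div (μ := μ) n
      exact Measurable.aestronglyMeasurable (by fun_prop)
    · rw [Real.norm_of_nonneg (Real.exp_pos _).le, Real.exp_le_one_iff, neg_nonpos]
      positivity
    · filter_upwards [hX.ae_tendsto_gwLimit hμ hμ1, h0] with ω hω hω0
      rw [hω0] at hω
      have hcont : Continuous fun x : ℝ => Real.exp (-(c * x)) := by fun_prop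
      have hcomp := (hcont.tendsto _).comp hω
      simpa [Function.comp_def] using hcomp
  have := le_of_tendsto' hlim hle
  linarith

lemma IsIIDArray.gwLimit_ne (hX : IsIIDArray X p P) (hp0 : p 0 = 0)
    (hμ : HasSum (fun i : ℕ => (p i).toReal * (i : ℝ)) μ) (hμ1 : 1 < μ)
    (hlog : Summable (fun i : ℕ => (p i).toReal * ((i : ℝ) * Real.log i)))
    {k : ℕ} (hk : μ < k) (hpk : p k ≠ 0) (y : ℝ) :
    ∀ᵐ ω ∂P, gwLimit μ (fun m i => X m i ω) ≠ y := by
  have hW := hX.aemeasurable_gwLimit hμ hμ1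
  have : IsProbabilityMeasure (P.map fun ω => gwLimit μ (fun m i => X m i ω)) :=
    Measure.isProbabilityMeasure_map hW
  have h := measure_singleton_eq_zero_of_map_eq_compound hp0 hμ1 (hX.map_mul_gwLimit hμ hμ1)
    ?_ ?_ hk hpk y
  · rw [Measure.map_apply_of_aemeasurable hW (measurableSet_singleton y)] at h
    exact measure_eq_zero_iff_ae_notMem.1 h
  · rw [Measure.map_apply_of_aemeasurable hW measurableSet_Iio]
    refine measure_eq_zero_iff_ae_notMem.2 ?_
    filter_upwards [hX.gwLimit_nonneg hμ hμ1] with ω hω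
    simpa using hω
  · rw [Measure.map_apply_of_aemeasurable hW (measurableSet_singleton 0).compl]
    intro h
    refine hX.map_gwLimit_ne_zero hμ hμ1 hlog ?_
    filter_upwards [measure_eq_zero_iff_ae_notMem.1 h] with ω hω
    simpa using hω

/-- The nonnegative terms `pₖ (μ - k)` sum to zero, so all vanish. This isolates the deterministic
case, the only one in which `Z_∞` has an atom. -/
lemma exists_eq_of_forall_le_mean (hμ : HasSum (fun i : ℕ => (p i).toReal * (i : ℝ)) μ)
    (h : ∀ k : ℕ, μ < k → p k = 0) : ∃ m : ℕ, (m : ℝ) = μ ∧ ∀ k ≠ m, p k = 0 := by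
  have h1 : HasSum (fun k : ℕ => (p k).toReal * (μ - k)) 0 := by
    have := ((hasSum_toReal p).mul_right μ).sub hμ
    rw [one_mul, sub_self] at this
    exact this.congr_fun fun k => by ring
  have h2 := (hasSum_zero_iff_of_nonneg fun k => ?_).1 h1
  · have h3 : ∀ k : ℕ, p k ≠ 0 → (k : ℝ) = μ := fun k hk => by
      have := (mul_eq_zero.1 (congrFun h2 k)).resolve_left
        (ENNReal.toReal_ne_zero.2 ⟨hk, p.apply_ne_top k⟩)
      linarith
    obtain ⟨m, hm⟩ := p.support_nonempty
    refine ⟨m, h3 m hm, fun k hkm => ?_⟩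
    by_contra hk
    exact hkm (by exact_mod_cast (h3 k hk).trans (h3 m hm).symm)
  · rcases lt_or_ge μ k with hk | hk
    · simp [h k hk]
    · exact mul_nonneg ENNReal.toReal_nonneg (by linarith)

lemma IsIIDArray.gwLimit_pos (hX : IsIIDArray X p P) (hp0 : p 0 = 0)
    (hμ : HasSum (fun i : ℕ => (p i).toReal * (i : ℝ)) μ) (hμ1 : 1 < μ)
    (hlog : Summable (fun i : ℕ => (p i).toReal * ((i : ℝ) * Real.log i))) :
    ∀ᵐ ω ∂P, 0 < gwLimit μ (fun m i => X m i ω) := by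
  by_cases h : ∃ k : ℕ, μ < k ∧ p k ≠ 0
  · obtain ⟨k, hk, hpk⟩ := h
    filter_upwards [hX.gwLimit_nonneg hμ hμ1, hX.gwLimit_ne hp0 hμ hμ1 hlog hk hpk 0] with ω h1 h2
    exact lt_of_le_of_ne h1 h2.symm
  · push Not at h
    obtain ⟨m, hm, hm'⟩ := exists_eq_of_forall_le_mean hμ h
    filter_upwards [hX.gw_div_eq_one hμ1 hm hm', hX.ae_tendsto_gwLimit hμ hμ1] with ω h1 h2
    simp only [h1] at h2
    rw [tendsto_nhds_unique h2 tendsto_const_nhds]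
    exact one_pos

/-- No continuity point needs to be assumed: either `y` is not an atom of the limit, or the sequence
is almost surely constant and even `y = 1` is harmless. -/
lemma IsIIDArray.tendsto_measure_lt_gw_div (hX : IsIIDArray X p P) (hp0 : p 0 = 0)
    (hμ : HasSum (fun i : ℕ => (p i).toReal * (i : ℝ)) μ) (hμ1 : 1 < μ)
    (hlog : Summable (fun i : ℕ => (p i).toReal * ((i : ℝ) * Real.log i))) (y : ℝ) :
    Tendsto (fun n : ℕ => P {ω | y < (galtonWatson (fun k i => X k i ω) n : ℝ) / μ ^ n}) atTop
      (𝓝 (P {ω | y < gwLimit μ (fun m i => X m i ω)})) := by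
  have hW := hX.aemeasurable_gwLimit hμ hμ1
  have hmk : P {ω | y < gwLimit μ (fun m i => X m i ω)} = P {ω | y < hW.mk _ ω} := by
    refine measure_congr ?_
    filter_upwards [hW.ae_eq_mk] with ω hω
    exact congrArg (fun z => y < z) hω
  rw [hmk]
  refine tendsto_measure_of_ae_tendsto_indicator_of_isFiniteMeasure atTop
    (measurableSet_lt measurable_const hW.measurable_mk)
    (fun n => measurableSet_lt measurable_const (hX.measurable_gw_div n)) ?_
  by_cases h : ∃ k : ℕ, μ < k ∧ p k ≠ 0
  · obtain ⟨k, hk, hpk⟩ := h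
    filter_upwards [hW.ae_eq_mk, hX.ae_tendsto_gwLimit hμ hμ1,
      hX.gwLimit_ne hp0 hμ hμ1 hlog hk hpk y] with ω h1 h2 h3
    rw [h1] at h2 h3
    rcases lt_or_gt_of_ne h3 with h | h
    · filter_upwards [h2.eventually_lt_const h] with n hn
      exact iff_of_false (not_lt.2 hn.le) (not_lt.2 h.le)
    · filter_upwards [h2.eventually_const_lt h] with n hn
      exact iff_of_true hn h
  · push Not at h
    obtain ⟨m, hm, hm'⟩ := exists_eq_of_forall_le_mean hμ h
    filter_upwards [hW.ae_eq_mk, hX.gw_div_eq_one hμ1 hm hm', hX.ae_tendsto_gwLimit hμ hμ1]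
      with ω h1 h2 h3
    rw [h1] at h3
    simp only [h2] at h3
    refine Eventually.of_forall fun n => ?_
    simp only [h2, tendsto_nhds_unique h3 tendsto_const_nhds]

lemma IsIIDArray.tendsto_measure_gw_le (hX : IsIIDArray X p P) (hp0 : p 0 = 0)
    (hμ : HasSum (fun i : ℕ => (p i).toReal * (i : ℝ)) μ) (hμ1 : 1 < μ)
    (hlog : Summable (fun i : ℕ => (p i).toReal * ((i : ℝ) * Real.log i))) (M : ℕ) :
    Tendsto (fun n : ℕ => P {ω | galtonWatson (fun k i => X k i ω) n ≤ M}) atTop (𝓝 0) := by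
  rw [← measure_empty (μ := P)]
  refine tendsto_measure_of_ae_tendsto_indicator_of_isFiniteMeasure atTop MeasurableSet.empty
    (fun n => measurableSet_le (hX.measurable_gw n) measurable_const) ?_
  filter_upwards [hX.ae_tendsto_gwLimit hμ hμ1, hX.gwLimit_pos hp0 hμ hμ1 hlog] with ω h1 h2
  have h3 : Tendsto (fun n : ℕ => (M : ℝ) / μ ^ n) atTop (𝓝 0) :=
    tendsto_const_nhds.div_atTop (tendsto_pow_atTop_atTop_of_one_lt hμ1)
  filter_upwards [h3.eventually_lt h1 h2] with n hn
  rw [div_lt_div_iff_of_pos_right (by positivity)] at hn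
  have : M < galtonWatson (fun k i => X k i ω) n := by exact_mod_cast hn
  simpa using this

end Limit

/-! ### Transfer to the number of rounds -/

section Rounds

/-- The permutation of `ℕ` that reverses the order of `0, …, n - 1`. -/
def revBelow (n m : ℕ) : ℕ := if m < n then n - 1 - m else m

lemma revBelow_injective (n : ℕ) : (revBelow n).Injective := by
  intro a b h
  simp only [revBelow] at h
  split_ifs at h <;> omega

lemma galtonWatson_revBelow (a : ℕ → ℕ → ℕ) (n : ℕ) :
    galtonWatson (fun m => a (revBelow n m)) n = initialLabel a n 1 :=
  galtonWatson_reverse a _ n fun m hm => by simp [revBelow, hm]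

/-- Used for `rounds`, whose sublevel sets are described by measurable events only where all
increments are positive and the infimum is finite. -/
lemma aemeasurable_of_ae_le_iff {Ω : Type*} [MeasurableSpace Ω] {P : Measure Ω} {f : Ω → ℕ}
    {H : ℕ → Set Ω} (hH : ∀ n, MeasurableSet (H n)) (h : ∀ᵐ ω ∂P, ∀ n, f ω ≤ n ↔ ω ∈ H n) :
    AEMeasurable f P := by
  have hs : ∀ k, NullMeasurableSet (f ⁻¹' {k}) P := fun k => by
    refine ((hH k).diff (MeasurableSet.iUnion fun j : Fin k => hH j)).nullMeasurableSet.congr ?_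
    filter_upwards [h] with ω hω
    refine propext (Iff.symm ?_)
    change f ω = k ↔ ω ∈ H k \ ⋃ j : Fin k, H j
    simp only [Set.mem_sdiff, Set.mem_iUnion, ← hω, not_exists, not_le]
    exact ⟨fun e => ⟨e.le, fun j => e ▸ j.2⟩, fun e => le_antisymm e.1 (by
      by_contra hlt
      have := e.2 ⟨f ω, by omega⟩
      simp at this)⟩
  refine NullMeasurable.aemeasurable fun s _ => ?_
  rw [← Set.biUnion_preimage_singleton]
  exact NullMeasurableSet.biUnion s.to_countable fun k _ => hs k

variable {Ω : Type*} [MeasurableSpace Ω] {P : Measure Ω} {p : PMF ℕ}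
  {ξ : ℕ → ℕ → Ω → ℕ}

lemma IsIIDArray.measurableSet_lt_initialLabel (hξ : IsIIDArray ξ p P) (M n : ℕ) :
    MeasurableSet {ω | M < initialLabel (fun m i => ξ m i ω) n 1} := by
  have h := (hξ.reindex (revBelow_injective n)).measurable_gw n
  have e : ∀ ω, galtonWatson (fun k i => ξ (revBelow n k) i ω) n
      = initialLabel (fun m i => ξ m i ω) n 1 := fun ω =>
    galtonWatson_revBelow (fun m i => ξ m i ω) n
  simp only [e] at h
  exact measurableSet_lt measurable_const h

variable [IsProbabilityMeasure P]

lemma IsIIDArray.measure_lt_initialLabel (hξ : IsIIDArray ξ p P) {Ω' : Type*} [MeasurableSpace Ω']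
    {P' : Measure Ω'} [IsProbabilityMeasure P'] {η : ℕ → ℕ → Ω' → ℕ} (hη : IsIIDArray η p P')
    (M n : ℕ) : P {ω | M < initialLabel (fun m i => ξ m i ω) n 1}
      = P' {ω | M < galtonWatson (fun m i => η m i ω) n} := by
  have h := (hξ.reindex (revBelow_injective n)).measure_eq hη n (Set.Ioi M)
  have e : ∀ ω, galtonWatson (fun k i => ξ (revBelow n k) i ω) n
      = initialLabel (fun m i => ξ m i ω) n 1 := fun ω =>
    galtonWatson_revBelow (fun m i => ξ m i ω) n
  simp only [e] at h
  exact h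

lemma one_le_rounds (a : ℕ → ℕ → ℕ) (M : ℕ) : 1 ≤ rounds a M := by
  refine le_sInf ?_
  rintro _ ⟨n, hn, rfl⟩
  exact Nat.one_le_cast.2 hn.1

variable {μ : ℝ}

/-- For every `n`, `P(T(M) = ∞) ≤ P(Z_{n+1} ≤ M)`, and the right side tends to `0` because `Z_∞ >
0`. -/
lemma IsIIDArray.rounds_lt_top (hξ : IsIIDArray ξ p P) (hp0 : p 0 = 0)
    (hμ : HasSum (fun i : ℕ => (p i).toReal * (i : ℝ)) μ) (hμ1 : 1 < μ)
    (hlog : Summable (fun i : ℕ => (p i).toReal * ((i : ℝ) * Real.log i))) (M : ℕ) :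
    ∀ᵐ ω ∂P, rounds (fun m i => ξ m i ω) M < ⊤ := by
  have hle : ∀ n, P {ω | ¬ rounds (fun m i => ξ m i ω) M < ⊤}
      ≤ P {ω | galtonWatson (fun k i => ξ k i ω) (n + 1) ≤ M} := fun n => by
    have h1 : P {ω | ¬ rounds (fun m i => ξ m i ω) M < ⊤}
        ≤ P {ω | M < initialLabel (fun m i => ξ m i ω) (n + 1) 1}ᶜ := by
      refine measure_mono_ae ?_
      filter_upwards [hξ.ae_pos hp0] with ω hω hr hlt
      exact hr (((rounds_le_iff hω M (n := n + 1) (by omega)).2 hlt).trans_lt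
        (ENat.natCast_lt_top _))
    refine h1.trans_eq ?_
    rw [prob_compl_eq_one_sub (hξ.measurableSet_lt_initialLabel M _),
      hξ.measure_lt_initialLabel hξ,
      ← prob_compl_eq_one_sub (measurableSet_lt measurable_const (hξ.measurable_gw _))]
    congr 1
    ext ω
    simp
  exact le_antisymm (ge_of_tendsto' ((tendsto_add_atTop_iff_nat 1).2
    (hξ.tendsto_measure_gw_le hp0 hμ hμ1 hlog M)) hle) bot_le

lemma IsIIDArray.toNat_rounds_le_iff (hξ : IsIIDArray ξ p P) (hp0 : p 0 = 0)
    (hμ : HasSum (fun i : ℕ => (p i).toReal * (i : ℝ)) μ) (hμ1 : 1 < μ)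
    (hlog : Summable (fun i : ℕ => (p i).toReal * ((i : ℝ) * Real.log i))) (M : ℕ) :
    ∀ᵐ ω ∂P, ∀ n, (rounds (fun m i => ξ m i ω) M).toNat ≤ n ↔
      ω ∈ {ω | n ≠ 0 ∧ M < initialLabel (fun m i => ξ m i ω) n 1} := by
  filter_upwards [hξ.rounds_lt_top hp0 hμ hμ1 hlog M, hξ.ae_pos hp0] with ω h1 h2 n
  have h3 : (rounds (fun m i => ξ m i ω) M).toNat ≤ n ↔ rounds (fun m i => ξ m i ω) M ≤ n := by
    lift rounds (fun m i => ξ m i ω) M to ℕ using h1.ne with r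
    simp
  rw [h3]
  rcases Nat.eq_zero_or_pos n with rfl | hn
  · refine iff_of_false (fun h => ?_) (by simp)
    have := (one_le_rounds (fun m i => ξ m i ω) M).trans h
    simp at this
  · rw [rounds_le_iff h2 M hn]
    exact ⟨fun h => ⟨hn.ne', h⟩, fun h => h.2⟩

lemma IsIIDArray.aemeasurable_toNat_rounds (hξ : IsIIDArray ξ p P) (hp0 : p 0 = 0)
    (hμ : HasSum (fun i : ℕ => (p i).toReal * (i : ℝ)) μ) (hμ1 : 1 < μ)
    (hlog : Summable (fun i : ℕ => (p i).toReal * ((i : ℝ) * Real.log i))) (M : ℕ) :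
    AEMeasurable (fun ω => (rounds (fun m i => ξ m i ω) M).toNat) P :=
  aemeasurable_of_ae_le_iff
    (fun n => (MeasurableSet.const (n ≠ 0)).inter (hξ.measurableSet_lt_initialLabel M n))
    (hξ.toNat_rounds_le_iff hp0 hμ hμ1 hlog M)

lemma IsIIDArray.tendsto_measure_rounds_sub_le (hξ : IsIIDArray ξ p P) (hp0 : p 0 = 0)
    (hμ : HasSum (fun i : ℕ => (p i).toReal * (i : ℝ)) μ) (hμ1 : 1 < μ)
    (hlog : Summable (fun i : ℕ => (p i).toReal * ((i : ℝ) * Real.log i)))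
    {Ω' : Type*} [MeasurableSpace Ω'] {P' : Measure Ω'} [IsProbabilityMeasure P']
    {η : ℕ → ℕ → Ω' → ℕ} (hη : IsIIDArray η p P') {x : ℝ} (hx : 0 < x) (k : ℤ) :
    Tendsto (fun n : ℕ => P {ω | ((rounds (fun m i => ξ m i ω) ⌊μ ^ n * x⌋₊).toNat : ℤ) - n ≤ k})
      atTop (𝓝 (P' {ω | μ ^ (-k) * x < gwLimit μ (fun m i => η m i ω)})) := by
  have hμ0 : 0 < μ := by linarith
  have hN : Tendsto (fun n : ℕ => ((n : ℤ) + k).toNat) atTop atTop :=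
    tendsto_atTop.2 fun b => by
      filter_upwards [eventually_ge_atTop (b + k.natAbs)] with n hn
      omega
  refine ((hη.tendsto_measure_lt_gw_div hp0 hμ hμ1 hlog (μ ^ (-k) * x)).comp hN).congr' ?_
  -- This ensures `n + k ≥ 1`, the range in which the duality for `rounds` is valid.
  filter_upwards [eventually_ge_atTop (k.natAbs + 1)] with n hn
  obtain ⟨N, hNk⟩ : ∃ N : ℕ, (N : ℤ) = n + k := ⟨((n : ℤ) + k).toNat, by omega⟩
  have hN1 : N ≠ 0 := by omega
  simp only [Function.comp_apply, ← hNk, Int.toNat_natCast]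
  have h1 : P {ω | ((rounds (fun m i => ξ m i ω) ⌊μ ^ n * x⌋₊).toNat : ℤ) - n ≤ k}
      = P {ω | ⌊μ ^ n * x⌋₊ < initialLabel (fun m i => ξ m i ω) N 1} := by
    refine measure_congr ?_
    filter_upwards [hξ.toNat_rounds_le_iff hp0 hμ hμ1 hlog ⌊μ ^ n * x⌋₊] with ω hω
    refine propext ?_
    change ((rounds (fun m i => ξ m i ω) ⌊μ ^ n * x⌋₊).toNat : ℤ) - n ≤ k
      ↔ ⌊μ ^ n * x⌋₊ < initialLabel (fun m i => ξ m i ω) N 1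
    have h2 := hω N
    simp only [hN1, ne_eq, not_false_eq_true, true_and] at h2
    rw [← h2]
    omega
  rw [h1, hξ.measure_lt_initialLabel hη]
  congr 1
  ext ω
  simp only [Set.mem_ofPred_eq]
  -- The floor disappears because the Galton-Watson process is integer-valued: `⌊y⌋ < Z` iff `y <
  -- Z`.
  rw [Nat.floor_lt (by positivity), lt_div_iff₀ (by positivity), ← zpow_natCast μ N, hNk,
    ← zpow_natCast μ n, zpow_add₀ hμ0.ne', zpow_neg]
  have : (μ ^ k)⁻¹ * x * (μ ^ (n : ℤ) * μ ^ k) = μ ^ (n : ℤ) * x := by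
    field_simp
  rw [this]

end Rounds

/-! ### Weak convergence on the integers -/

section Weak

/-- Convergence of the distribution functions of integer-valued variables implies weak
convergence. -/
lemma tendsto_probabilityMeasure_int {ν : ℕ → ProbabilityMeasure ℤ} {ν' : ProbabilityMeasure ℤ}
    (h : ∀ k : ℤ, Tendsto (fun n => (ν n : Measure ℤ) (Set.Iic k)) atTop
      (𝓝 ((ν' : Measure ℤ) (Set.Iic k)))) : Tendsto ν atTop (𝓝 ν') := by
  have hsing : ∀ (m : ProbabilityMeasure ℤ) (k : ℤ),
      (m : Measure ℤ) {k} = (m : Measure ℤ) (Set.Iic k) - (m : Measure ℤ) (Set.Iic (k - 1)) := by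
    intro m k
    rw [← measure_sdiff (Set.Iic_subset_Iic.2 (by omega)) MeasurableSet.of_discrete.nullMeasurableSet
      (measure_ne_top _ _)]
    congr 1
    ext j
    simp only [Set.mem_singleton_iff, Set.mem_sdiff, Set.mem_Iic]
    omega
  refine IsPiSystem.tendsto_probabilityMeasure_of_tendsto_of_mem
    (S := Set.range fun k : ℤ => ({k} : Set ℤ)) ?_ (fun _ _ => MeasurableSet.of_discrete) ?_ ?_
  · rintro _ ⟨a, rfl⟩ _ ⟨b, rfl⟩ ⟨c, hc⟩
    obtain ⟨rfl, rfl⟩ : c = a ∧ c = b := by simpa using hc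
    exact ⟨c, by simp⟩
  · exact fun u _ x hx => ⟨{x}, ⟨x, rfl⟩, by simp, by simpa using hx⟩
  · rintro _ ⟨k, rfl⟩
    have := ENNReal.Tendsto.sub (h k) (h (k - 1)) (Or.inl (measure_ne_top _ _))
    simp only [← hsing] at this
    exact (ENNReal.tendsto_toNNReal (measure_ne_top _ _)).comp this

end Weak

end LeaderElection

theorem mainTheorem7
    -- the law `(p_i)` of `ξ` on `{1, 2, …}`, with mean `μ ∈ (1, ∞)` and `E ξ log ξ < ∞`
    (p : PMF ℕ) (hp0 : p 0 = 0)
    (μ : ℝ) (hμ : HasSum (fun i : ℕ => (p i).toReal * (i : ℝ)) μ) (hμ1 : 1 < μ)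
    (hlog : Summable (fun i : ℕ => (p i).toReal * ((i : ℝ) * Real.log i)))
    -- the increments of the random walks used in the successive rounds
    {Ω : Type*} [MeasurableSpace Ω] (P : Measure Ω) [IsProbabilityMeasure P]
    (ξ : ℕ → ℕ → Ω → ℕ) (hξ : LeaderElection.IsIIDArray ξ p P)
    -- the offspring variables of a Galton-Watson process, possibly on another probability space
    {Ω' : Type*} [MeasurableSpace Ω'] (P' : Measure Ω') [IsProbabilityMeasure P']
    (η : ℕ → ℕ → Ω' → ℕ) (hη : LeaderElection.IsIIDArray η p P') :
    -- `μ⁻ⁿ Zₙ` converges to `Z_∞` almost surely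
    (∀ᵐ ω ∂P', Tendsto
      (fun n : ℕ => (LeaderElection.galtonWatson (fun m i => η m i ω) n : ℝ) / μ ^ n) atTop
      (𝓝 (LeaderElection.gwLimit μ (fun m i => η m i ω)))) ∧
    -- `T(M)` is finite almost surely
    (∀ M : ℕ, ∀ᵐ ω ∂P, LeaderElection.rounds (fun m i => ξ m i ω) M < ⊤) ∧
    -- convergence in distribution to the law `ν` of `T'(x)` on `ℤ`
    ∀ x : ℝ, 0 < x → ∃ ν : ProbabilityMeasure ℤ,
      (∀ k : ℤ, (ν : Measure ℤ) (Set.Iic k) =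
        P' {ω | μ ^ (-k) * x < LeaderElection.gwLimit μ (fun m i => η m i ω)}) ∧
      TendstoInDistribution
        (fun (n : ℕ) (ω : Ω) =>
          ((LeaderElection.rounds (fun m i => ξ m i ω) ⌊μ ^ n * x⌋₊).toNat : ℤ) - (n : ℤ))
        atTop (id : ℤ → ℤ) (fun _ => P) (ν : Measure ℤ) := by
  refine ⟨hη.ae_tendsto_gwLimit hμ hμ1, hξ.rounds_lt_top hp0 hμ hμ1 hlog, fun x hx => ?_⟩
  have hμ0 : 0 < μ := by linarith
  have hlogμ : 0 < Real.log μ := Real.log_pos hμ1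
  -- An explicit `T'(x)`: the least integer `k` with `μ⁻ᵏ x < Z_∞`. Taking `ν` as its law avoids
  -- checking that the prescribed function is a distribution function.
  have hT : AEMeasurable (fun ω =>
      ⌊Real.log (x / LeaderElection.gwLimit μ (fun m i => η m i ω)) / Real.log μ⌋ + 1) P' :=
    (Int.measurable_floor.comp_aemeasurable (((Real.measurable_log.comp_aemeasurable
      ((hη.aemeasurable_gwLimit hμ hμ1).const_div x))).div_const _)).add_const 1
  have hcdf : ∀ k : ℤ, P'.map (fun ω =>
      ⌊Real.log (x / LeaderElection.gwLimit μ (fun m i => η m i ω)) / Real.log μ⌋ + 1) (Set.Iic k)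
      = P' {ω | μ ^ (-k) * x < LeaderElection.gwLimit μ (fun m i => η m i ω)} := by
    intro k
    rw [Measure.map_apply_of_aemeasurable hT measurableSet_Iic]
    refine measure_congr ?_
    filter_upwards [hη.gwLimit_pos hp0 hμ hμ1 hlog] with ω hW
    refine propext ?_
    change ⌊Real.log (x / LeaderElection.gwLimit μ (fun m i => η m i ω)) / Real.log μ⌋ + 1 ≤ k
      ↔ μ ^ (-k) * x < LeaderElection.gwLimit μ (fun m i => η m i ω)
    rw [Int.add_one_le_iff, Int.floor_lt, div_lt_iff₀ hlogμ, ← Real.log_zpow,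
      Real.log_lt_log_iff (by positivity) (by positivity), div_lt_iff₀ hW, zpow_neg,
      inv_mul_lt_iff₀ (by positivity)]
  let ν : ProbabilityMeasure ℤ := ⟨P'.map _, Measure.isProbabilityMeasure_map hT⟩
  have hm : ∀ n : ℕ, AEMeasurable (fun ω =>
      ((LeaderElection.rounds (fun m i => ξ m i ω) ⌊μ ^ n * x⌋₊).toNat : ℤ) - (n : ℤ)) P := fun n =>
    (measurable_from_top (f := fun j : ℕ => (j : ℤ) - n)).comp_aemeasurable
      (hξ.aemeasurable_toNat_rounds hp0 hμ hμ1 hlog _)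
  refine ⟨ν, hcdf, ⟨hm, aemeasurable_id, ?_⟩⟩
  refine LeaderElection.tendsto_probabilityMeasure_int fun k => ?_
  simp only [ProbabilityMeasure.coe_mk, Measure.map_id]
  rw [show (ν : Measure ℤ) (Set.Iic k) = _ from hcdf k]
  refine (hξ.tendsto_measure_rounds_sub_le hp0 hμ hμ1 hlog hη hx k).congr fun n => ?_
  rw [Measure.map_apply_of_aemeasurable (hm n) measurableSet_Iic]
  rfl
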